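/- Let $C^\infty(\mathbb R/\mathbb Z)$ be the space of smooth $1$-periodic functions $U:\mathbb R\to\mathbb R$ with the Whitney $C^\infty$ topology. Let $\Omega_{rev}\subset C^\infty(\mathbb R/\mathbb Z)$, with the induced topology, be the set of those $U>0$ that have exactly one local minimum point and exactly one local maximum point in $[0,1)$ and all of whose critical points are nondegenerate (so that the minimum and the maximum are the only critical points in $[0,1)$). For $U\in\Omega_{rev}$ put $c_1=\max U$, $c_2=\min U$ and, for $0\le c\le c_1$, $$F_1(c)=\int_{\{q\in[0,1)\,:\,U(q)\ge c\}}(U(q)-c)^{1/2}\,dq,\qquad F_2(c)=c^{1/2},$$ and let $$\kappa(c)=\frac{F_2''F_1'-F_1''F_2'}{\big((F_1')^2+(F_2')^2\big)^{3/2}}(c),\qquad c\in(0,c_2)\cup(c_2,c_1],$$ be the curvature of the plane curve $c\mapsto(F_1(c),F_2(c))$, where derivatives at $c=c_1$ are left derivatives. A real number $\alpha$ is called typical if there are $\tau>0$ and $\delta>0$ such that $$|k_1+\alpha k_2|\ \ge\ \frac{\delta}{|k_2|\,(\log(1+|k_2|))^{\tau}}\qquad\text{for all } k_1,k_2\in\mathbb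 Z,\ k_2\ne0 .$$ The metric of revolution $U(q_1)(dq_1^2+dq_2^2)$ on $\mathbb R^2/\mathbb Z^2$ is called nondegenerate if $U\in\Omega_{rev}$ and 1. $\kappa$ has only finitely many zeros on $(c_2,c_1]$, each of first order (that is, $\kappa'\neq0$ there); 2. if $\kappa(\tilde c)=0$, then $F_2'(\tilde c)/F_1'(\tilde c)$ is typical; 3. $F_2'(c_1)/F_1'(c_1)$ is typical; 4. $F_2(c_2)/F_1(c_2)$ is typical. **Theorem.** The set of $U\in\Omega_{rev}$ whose metric of revolution is nondegenerate is dense in $\Omega_{rev}$. -/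

import Mathlib

open scoped ContDiff

namespace RevolutionTorus

/-- Smooth functions on the circle `ℝ / ℤ`, as smooth `1`-periodic functions on `ℝ`. -/
structure SmoothPeriodic where
  toFun : ℝ → ℝ
  contDiff : ContDiff ℝ ∞ toFun
  periodic : Function.Periodic toFun 1

/-- The `k`-jet of `f` at `q`, in `J^k(ℝ/ℤ, ℝ) = ℝ/ℤ × ℝ^(k+1)`. -/
noncomputable def SmoothPeriodic.jet (k : ℕ) (f : SmoothPeriodic) (q : ℝ) :
    UnitAddCircle × (Fin (k + 1) → ℝ) :=
  ((q : UnitAddCircle), fun i => iteratedDeriv (i : ℕ) f.toFun q)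

/-- The Whitney `C^∞` topology: it is generated by the sets of all `f` whose `k`-jet takes its
values in `O`, where `k` is a natural number and `O` is an open subset of the space of `k`-jets. -/
instance whitneyTopology : TopologicalSpace SmoothPeriodic :=
  TopologicalSpace.generateFrom
    {W | ∃ (k : ℕ) (O : Set (UnitAddCircle × (Fin (k + 1) → ℝ))), IsOpen O ∧
      W = {f : SmoothPeriodic | ∀ q : ℝ, f.jet k q ∈ O}}

/-- The set `Ω_rev`: positive smooth `1`-periodic functions with exactly one minimum point and
exactly one maximum point in `[0, 1)`, all critical points being nondegenerate. -/
def OmegaRev : Set SmoothPeriodic :=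
  {U | (∀ q, 0 < U.toFun q) ∧
    (∃! m, m ∈ Set.Ico (0 : ℝ) 1 ∧ IsLocalMin U.toFun m) ∧
    (∃! M, M ∈ Set.Ico (0 : ℝ) 1 ∧ IsLocalMax U.toFun M) ∧
    ∀ q, deriv U.toFun q = 0 → deriv (deriv U.toFun) q ≠ 0}

/-- A real number `α` is typical if, for some `τ > 0` and `δ > 0`,
`|k₁ + α k₂| ≥ δ / (|k₂| (log (1 + |k₂|))^τ)` for all integers `k₁` and `k₂ ≠ 0`. -/
def IsTypical (α : ℝ) : Prop :=
  ∃ τ : ℝ, 0 < τ ∧ ∃ δ : ℝ, 0 < δ ∧ ∀ k₁ k₂ : ℤ, k₂ ≠ 0 →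
    δ / (|(k₂ : ℝ)| * Real.log (1 + |(k₂ : ℝ)|) ^ τ) ≤ |(k₁ : ℝ) + α * (k₂ : ℝ)|

/-- The maximum of `U`. -/
noncomputable def c₁ (U : ℝ → ℝ) : ℝ := sSup (U '' Set.Icc 0 1)

/-- The minimum of `U`. -/
noncomputable def c₂ (U : ℝ → ℝ) : ℝ := sInf (U '' Set.Icc 0 1)

/-- First coordinate of the curve `γ`. -/
noncomputable def F₁ (U : ℝ → ℝ) (c : ℝ) : ℝ :=
  ∫ q in {q : ℝ | q ∈ Set.Ico (0 : ℝ) 1 ∧ c ≤ U q}, Real.sqrt (U q - c)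

/-- Second coordinate of the curve `γ`. -/
noncomputable def F₂ (c : ℝ) : ℝ := Real.sqrt c

/-- The derivative of a function on the parameter interval `[0, c₁]` of `γ`: the usual one at
interior points, the left derivative at `c₁`. -/
noncomputable def D (U : ℝ → ℝ) (f : ℝ → ℝ) (c : ℝ) : ℝ :=
  derivWithin f (Set.Icc 0 (c₁ U)) c

/-- The signed curvature of `γ = (F₁, F₂)`, for `c` in `(0, c₂) ∪ (c₂, c₁]`. -/
noncomputable def curvature (U : ℝ → ℝ) (c : ℝ) : ℝ :=
  (D U (D U F₂) c * D U (F₁ U) c - D U (D U (F₁ U)) c * D U F₂ c) /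
    (D U (F₁ U) c ^ 2 + D U F₂ c ^ 2) ^ (3 / 2 : ℝ)

/-- The metric of revolution `U(q₁) (dq₁² + dq₂²)` is nondegenerate. -/
structure IsNondegenerate (U : SmoothPeriodic) : Prop where
  mem_omegaRev : U ∈ OmegaRev
  finite_zeros :
    {c | c ∈ Set.Ioc (c₂ U.toFun) (c₁ U.toFun) ∧ curvature U.toFun c = 0}.Finite
  first_order : ∀ c ∈ Set.Ioc (c₂ U.toFun) (c₁ U.toFun), curvature U.toFun c = 0 →
    D U.toFun (curvature U.toFun) c ≠ 0
  typical_zeros : ∀ c ∈ Set.Ioo 0 (c₂ U.toFun) ∪ Set.Ioc (c₂ U.toFun) (c₁ U.toFun),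
    curvature U.toFun c = 0 → IsTypical (D U.toFun F₂ c / D U.toFun (F₁ U.toFun) c)
  typical_max :
    IsTypical (D U.toFun F₂ (c₁ U.toFun) / D U.toFun (F₁ U.toFun) (c₁ U.toFun))
  typical_min : IsTypical (F₂ (c₂ U.toFun) / F₁ U.toFun (c₂ U.toFun))

end RevolutionTorus

/-!
The function `U` is approximated by `U + t` with a constant `t`: for almost every small `t` the
metric belonging to `U + t` is nondegenerate, and `t ↦ U + t` is continuous for the Whitney
topology (`dense_of_ae_addConst`).

Write `G = -F₁'`, `G₁ = -F₁''` for the function `F₁` of `U`. As `F₁` of `U + t` at `x + t` equals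
`F₁` of `U` at `x`, while `F₂` does not depend on `U`, the curvature belonging to `U + t` vanishes
at `x + t` if and only if `G x + 2 (x + t) G₁ x = 0`, that is, `t = Φ x` with
`Φ x = -x - G x / (2 G₁ x)` (`zeroShift`). The zeros are simple exactly when `t` is a regular value
of `Φ`, so by Sard's theorem they are simple for almost every `t`. The square of the slope
`F₂' / F₁'` at such a zero is `Q x = -G₁ x / (2 G x ^ 3)` (`slopeSq`). Along a fixed curve the slope
is stationary where the curvature vanishes, so `Q'` vanishes only where `Φ'` does. The set of
non-typical numbers is null by the Borel–Cantelli lemma (`volume_not_isTypical`), hence so is the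
set of `x` with `Φ' x ≠ 0` and a non-typical slope, and so is its image under `Φ`
(`IsJet.volume_image_zeroShift`). The slopes at `c₁` and at `c₂` depend on `t` through `√(c₁ + t)`
and `√(c₂ + t)` only, and are typical for almost every `t` as well.

It remains to control `F₁`. In the coordinate `y` with `U = c₁ - y ^ 2` on one period between two
minimum points, with inverse `ψ` (`exists_isMorseInverse`), the substitution `y = r sin θ`,
`r = √(c₁ - c)`, and an integration by parts give `G c = 1/2 ∫ ψ'(r sin θ) dθ`, an even smooth
function of `r`. Hence `F₁` has three derivatives on `(c₂, c₁)` and is `C²` up to `c₁`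
(`IsMorseInverse.isJet`), so that the zeros of the curvature do not accumulate at `c₁` once
`t ≠ Φ c₁`. They do not accumulate at `c₂` either, since `F₁''` dominates
`F₁'` there (`IsMorseInverse.exists_near_min`). On `(0, c₂)` the curvature is positive
(`curvature_ne_zero_of_lt_min`).
-/

open MeasureTheory Set Filter Topology
open scoped NNReal

namespace RevolutionTorus

/-! ### Null sets under differentiable maps -/

/-- A function with nonvanishing derivative pulls null sets back to null sets. -/
theorem volume_eq_zero_of_volume_image_eq_zero {f f' : ℝ → ℝ} {s : Set ℝ}
    (hf : ∀ x ∈ s, HasDerivWithinAt f (f' x) s x) (hf' : ∀ x ∈ s, f' x ≠ 0)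
    (h : volume (f '' s) = 0) : volume s = 0 := by
  classical
  rcases s.eq_empty_or_nonempty with rfl | hne
  · simp
  let r : (ℝ →L[ℝ] ℝ) → ℝ≥0 := fun A => if A 1 = 0 then 1 else ‖A 1‖₊ / 2
  have rpos : ∀ A, r A ≠ 0 := by
    intro A
    by_cases hA : A 1 = 0 <;> simp [r, hA]
  obtain ⟨t, A, -, -, hst, happ, hA⟩ := exists_partition_approximatesLinearOn_of_hasFDerivWithinAt
    f s (fun x => ContinuousLinearMap.toSpanSingleton ℝ (f' x))
    (fun x hx => (hf x hx).hasFDerivWithinAt) r rpos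
  have key : ∀ n, volume (s ∩ t n) = 0 := by
    intro n
    obtain ⟨y, hy, hAy⟩ := hA hne n
    have hA1 : A n 1 ≠ 0 := by
      rw [hAy]; simpa using hf' y hy
    have hpos : 0 < ‖A n 1‖ := norm_pos_iff.2 hA1
    -- on each piece `f` expands distances by at least the factor `|A n 1| / 2`
    have hanti : ∀ x ∈ s ∩ t n, ∀ z ∈ s ∩ t n, ‖A n 1‖ / 2 * |x - z| ≤ |f x - f z| := by
      intro x hx z hz
      have h1 := happ n x hx z hz
      simp only [r, hA1, if_false] at h1
      have h2 : A n (x - z) = (x - z) * A n 1 := by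
        rw [← smul_eq_mul, ← map_smul]; simp
      rw [h2] at h1
      simp only [NNReal.coe_div, coe_nnnorm, NNReal.coe_ofNat, Real.norm_eq_abs] at h1 ⊢
      have h3 : |(x - z) * A n 1| ≤ |f x - f z| + |f x - f z - (x - z) * A n 1| := by
        rw [abs_sub_comm (f x - f z)]
        have := abs_add_le (f x - f z) ((x - z) * A n 1 - (f x - f z))
        simpa using this
      rw [abs_mul] at h3
      nlinarith
    have hinj : InjOn f (s ∩ t n) := by
      intro x hx z hz hxz
      have := hanti x hx z hz
      rw [hxz, sub_self, abs_zero] at this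
      have h0 : |x - z| = 0 := by
        by_contra h0
        have : 0 < |x - z| := lt_of_le_of_ne (abs_nonneg _) (Ne.symm h0)
        have := mul_pos (half_pos hpos) this
        linarith
      exact sub_eq_zero.1 (abs_eq_zero.1 h0)
    have hlip : LipschitzOnWith (‖A n 1‖₊ / 2)⁻¹ (Function.invFunOn f (s ∩ t n))
        (f '' (s ∩ t n)) := by
      refine LipschitzOnWith.of_dist_le_mul ?_
      rintro _ ⟨x, hx, rfl⟩ _ ⟨z, hz, rfl⟩
      rw [hinj.leftInvOn_invFunOn hx, hinj.leftInvOn_invFunOn hz, Real.dist_eq, Real.dist_eq]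
      have := hanti x hx z hz
      simp only [NNReal.coe_inv, NNReal.coe_div, coe_nnnorm, NNReal.coe_ofNat]
      rw [inv_mul_eq_div, le_div_iff₀ (half_pos hpos)]
      linarith
    have him := hlip.hausdorffMeasure_image_le (d := 1) zero_le_one
    rw [hinj.leftInvOn_invFunOn.image_image, hausdorffMeasure_real] at him
    have h0 : volume (f '' (s ∩ t n)) = 0 := measure_mono_null (image_mono inter_subset_left) h
    rw [h0, mul_zero] at him
    exact le_antisymm him zero_le
  refine measure_mono_null (?_ : s ⊆ ⋃ n, s ∩ t n) (measure_iUnion_null key)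
  rw [← inter_iUnion]
  exact subset_inter Subset.rfl hst

/-- If the derivatives of `Φ` and `Q` on `s` are such that `Φ' = 0` wherever `Q' = 0`, and `Q`
maps `s` to a null set, then so does `Φ`. -/
theorem volume_image_eq_zero_of_volume_image_eq_zero {Φ Φ' Q Q' : ℝ → ℝ} {s : Set ℝ}
    (hΦ : ∀ x ∈ s, HasDerivAt Φ (Φ' x) x) (hQ : ∀ x ∈ s, HasDerivAt Q (Q' x) x)
    (h : ∀ x ∈ s, Q' x = 0 → Φ' x = 0) (hs : volume (Q '' s) = 0) : volume (Φ '' s) = 0 := by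
  have h1 : volume (Φ '' (s ∩ {x | Q' x = 0})) = 0 := by
    refine addHaar_image_eq_zero_of_det_fderivWithin_eq_zero volume
      (f' := fun x => ContinuousLinearMap.toSpanSingleton ℝ (Φ' x))
      (fun x hx => (hΦ x hx.1).hasDerivWithinAt.hasFDerivWithinAt) ?_
    intro x hx
    rw [h x hx.1 hx.2]
    simp [ContinuousLinearMap.det]
  have h2 : volume (Φ '' (s ∩ {x | Q' x ≠ 0})) = 0 := by
    refine addHaar_image_eq_zero_of_differentiableOn_of_addHaar_eq_zero volume
      (fun x hx => (hΦ x hx.1).differentiableAt.differentiableWithinAt) ?_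
    refine volume_eq_zero_of_volume_image_eq_zero (f := Q) (f' := Q')
      (fun x hx => (hQ x hx.1).hasDerivWithinAt) (fun x hx => hx.2) ?_
    exact measure_mono_null (image_mono inter_subset_left) hs
  refine measure_mono_null ?_ (measure_union_null h1 h2)
  rw [← image_union]
  refine image_mono fun x hx => ?_
  by_cases hx0 : Q' x = 0
  · exact Or.inl ⟨hx, hx0⟩
  · exact Or.inr ⟨hx, hx0⟩

/-! ### Almost every real number is typical -/

theorem summable_inv_mul_log_sq :
    Summable fun n : ℕ => 1 / ((n : ℝ) * Real.log (1 + n) ^ 2) := by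
  have hlog : ∀ n : ℕ, 0 ≤ Real.log (1 + n) := fun n =>
    Real.log_nonneg (by have := n.cast_nonneg (α := ℝ); linarith)
  rw [← summable_condensed_iff_of_nonneg]
  · have h2 : 0 < Real.log 2 := Real.log_pos one_lt_two
    have hs : Summable fun k : ℕ => 1 / Real.log 2 ^ 2 * (1 / (k : ℝ) ^ 2) :=
      (Real.summable_one_div_nat_pow.2 one_lt_two).mul_left _
    refine (summable_nat_add_iff 1).1 (Summable.of_nonneg_of_le (fun k => ?_) (fun k => ?_)
      ((summable_nat_add_iff 1).2 hs))
    · positivity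
    · have hp : (0 : ℝ) < 2 ^ (k + 1) := by positivity
      have h3 : ((k + 1 : ℕ) : ℝ) * Real.log 2 ≤ Real.log (1 + 2 ^ (k + 1)) := by
        rw [← Real.log_pow]
        exact Real.log_le_log hp (by linarith)
      have h4 : 0 < ((k + 1 : ℕ) : ℝ) * Real.log 2 := by positivity
      have h5 := pow_le_pow_left₀ h4.le h3 2
      have : (2 : ℝ) ^ (k + 1) * (1 / (((2 ^ (k + 1) : ℕ) : ℝ) *
          Real.log (1 + ((2 ^ (k + 1) : ℕ) : ℝ)) ^ 2)) = 1 / Real.log (1 + 2 ^ (k + 1)) ^ 2 := by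
        push_cast
        field_simp
      rw [this, div_mul_div_comm, one_mul]
      refine one_div_le_one_div_of_le (by positivity) ?_
      rw [mul_comm, ← mul_pow]
      exact h5
  · intro n
    have := hlog n
    positivity
  · intro m n hm hmn
    have hm' : (0 : ℝ) < m := by exact_mod_cast hm
    have hmn' : (m : ℝ) ≤ n := by exact_mod_cast hmn
    have h1 : 0 < Real.log (1 + m) := Real.log_pos (by linarith)
    have h2 : Real.log (1 + m) ≤ Real.log (1 + n) := Real.log_le_log (by linarith) (by linarith)
    refine one_div_le_one_div_of_le (by positivity) ?_
    exact mul_le_mul hmn' (pow_le_pow_left₀ h1.le h2 2) (by positivity) (by positivity)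

/-- An irrational number `α` is typical, with exponent `τ = 2`, as soon as the lower bound with
`δ = 1` holds for all large `q`: the finitely many other `q` only lower `δ`. -/
theorem isTypical_of_eventually {α : ℝ} (hα : Irrational α)
    (h : ∀ᶠ q : ℕ in atTop,
      1 / ((q : ℝ) * Real.log (1 + q) ^ 2) ≤ |α * q - round (α * q)|) : IsTypical α := by
  obtain ⟨N, hN⟩ := eventually_atTop.1 h
  have hlog : ∀ q : ℕ, 0 < q → 0 < (q : ℝ) * Real.log (1 + q) ^ 2 := by
    intro q hq
    have hq' : (0 : ℝ) < q := by exact_mod_cast hq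
    have := Real.log_pos (x := 1 + q) (by linarith)
    positivity
  let d : ℕ → ℝ := fun q => |α * q - round (α * q)| * ((q : ℝ) * Real.log (1 + q) ^ 2)
  have hd : ∀ q : ℕ, 0 < q → 0 < d q := by
    intro q hq
    refine mul_pos (abs_pos.2 ?_) (hlog q hq)
    exact sub_ne_zero.2 ((hα.mul_natCast hq.ne').ne_int _)
  -- only finitely many denominators are exceptional
  obtain ⟨δ, hδ, hδd⟩ : ∃ δ > 0, ∀ q : ℕ, 0 < q → δ ≤ d q := by
    let s := insert 1 ((Finset.Icc 1 N).image d)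
    have hs : s.Nonempty := Finset.insert_nonempty _ _
    refine ⟨s.min' hs, ?_, fun q hq => ?_⟩
    · rw [gt_iff_lt, Finset.lt_min'_iff]
      intro x hx
      simp only [s, Finset.mem_insert, Finset.mem_image, Finset.mem_Icc] at hx
      rcases hx with rfl | ⟨q, hq, rfl⟩
      · exact one_pos
      · exact hd q hq.1
    · by_cases hqN : q ≤ N
      · exact Finset.min'_le _ _ (Finset.mem_insert_of_mem
          (Finset.mem_image_of_mem _ (Finset.mem_Icc.2 ⟨hq, hqN⟩)))
      · refine (Finset.min'_le _ 1 (Finset.mem_insert_self _ _)).trans ?_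
        have := hN q (by omega)
        rwa [div_le_iff₀ (hlog q hq)] at this
  refine ⟨2, two_pos, δ, hδ, fun k₁ k₂ hk => ?_⟩
  have hq : 0 < k₂.natAbs := Int.natAbs_pos.2 hk
  have hcast : |(k₂ : ℝ)| = (k₂.natAbs : ℝ) := by
    rw [Nat.cast_natAbs, Int.cast_abs]
  rw [hcast, Real.rpow_two, div_le_iff₀ (hlog _ hq)]
  refine (hδd _ hq).trans (mul_le_mul_of_nonneg_right ?_ (hlog _ hq).le)
  rcases Int.natAbs_eq k₂ with h2 | h2
  · have h3 : (k₂ : ℝ) = (k₂.natAbs : ℝ) := by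
      conv_lhs => rw [h2]
      simp
    rw [h3]
    have := round_le (α * (k₂.natAbs : ℝ)) (-k₁)
    refine this.trans (le_of_eq ?_)
    push_cast
    congr 1; ring
  · have h3 : (k₂ : ℝ) = -(k₂.natAbs : ℝ) := by
      conv_lhs => rw [h2]
      simp
    rw [h3]
    have := round_le (α * (k₂.natAbs : ℝ)) k₁
    refine this.trans (le_of_eq ?_)
    rw [abs_sub_comm]
    congr 1; ring

/-- The set in question is covered by the intervals of radius `ε / q` around the fractions with
denominator `q` in a neighbourhood of `[-K, K]`. -/
theorem volume_close_to_int_le (K : ℕ) {q : ℕ} (hq : 0 < q) {ε : ℝ} (hε : 0 ≤ ε) :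
    volume {α : ℝ | α ∈ Icc (-(K : ℝ)) K ∧ |α * q - round (α * q)| < ε} ≤
      ENNReal.ofReal ((2 * K + 3) * (2 * ε)) := by
  have hq' : (0 : ℝ) < q := by exact_mod_cast hq
  have hq1 : (1 : ℝ) ≤ q := by exact_mod_cast hq
  have hsub : {α : ℝ | α ∈ Icc (-(K : ℝ)) K ∧ |α * q - round (α * q)| < ε} ⊆
      ⋃ p ∈ Finset.Icc (-(K * q + 1 : ℤ)) (K * q + 1), Metric.ball ((p : ℝ) / q) (ε / q) := by
    rintro α ⟨⟨hα1, hα2⟩, hα⟩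
    simp only [mem_iUnion]
    refine ⟨round (α * q), ?_, ?_⟩
    · have h1 := abs_le.1 (abs_sub_round (α * q))
      have h2 : α * q ≤ K * q := mul_le_mul_of_nonneg_right hα2 hq'.le
      have h3 : -(K : ℝ) * q ≤ α * q := mul_le_mul_of_nonneg_right hα1 hq'.le
      rw [Finset.mem_Icc]
      constructor
      · have : (-(K * q + 1 : ℤ) : ℝ) ≤ round (α * q) := by push_cast; linarith
        exact_mod_cast this
      · have : (round (α * q) : ℝ) ≤ (K * q + 1 : ℤ) := by push_cast; linarith
        exact_mod_cast this
    · rw [Metric.mem_ball, Real.dist_eq, lt_div_iff₀ hq', ← abs_of_pos hq', ← abs_mul,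
        abs_of_pos hq', sub_mul, div_mul_cancel₀ _ hq'.ne']
      exact hα
  refine (measure_mono hsub).trans ((measure_biUnion_finset_le _ _).trans ?_)
  simp only [Real.volume_ball, Finset.sum_const, Int.card_Icc, nsmul_eq_mul]
  have hc : ((((K * q + 1 + 1 - -(K * q + 1) : ℤ)).toNat : ℕ) : ℝ) = 2 * K * q + 3 := by
    have h0 : (K * q + 1 + 1 - -(K * q + 1) : ℤ) = ((2 * K * q + 3 : ℕ) : ℤ) := by push_cast; ring
    rw [h0, Int.toNat_natCast]
    push_cast; ring
  rw [← ENNReal.ofReal_natCast, ← ENNReal.ofReal_mul (by positivity), hc]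
  refine ENNReal.ofReal_le_ofReal ?_
  have : (2 * (K : ℝ) * q + 3) * (2 * (ε / q)) = (2 * K + 3 / q) * (2 * ε) := by
    field_simp
  rw [this]
  refine mul_le_mul_of_nonneg_right ?_ (by positivity)
  have : 3 / (q : ℝ) ≤ 3 := div_le_self (by norm_num) hq1
  linarith

/-- Almost every real number is typical, by the convergence half of Khinchin's theorem. -/
theorem volume_not_isTypical : volume {α : ℝ | ¬ IsTypical α} = 0 := by
  have hK : ∀ K : ℕ, volume {α : ℝ | ∃ᶠ q : ℕ in atTop, α ∈ Icc (-(K : ℝ)) K ∧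
      |α * q - round (α * q)| < 1 / ((q : ℝ) * Real.log (1 + q) ^ 2)} = 0 := by
    intro K
    refine measure_setOfPred_frequently_eq_zero (p := fun (q : ℕ) (α : ℝ) => α ∈ Icc (-(K : ℝ)) K ∧
      |α * q - round (α * q)| < 1 / ((q : ℝ) * Real.log (1 + q) ^ 2)) ?_
    have hs : Summable fun q : ℕ =>
        (2 * (K : ℝ) + 3) * (2 * (1 / ((q : ℝ) * Real.log (1 + q) ^ 2))) :=
      (summable_inv_mul_log_sq.mul_left 2).mul_left _
    refine ne_top_of_le_ne_top hs.tsum_ofReal_ne_top (ENNReal.tsum_le_tsum fun q => ?_)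
    rcases Nat.eq_zero_or_pos q with rfl | hq
    · simp
    · exact volume_close_to_int_le K hq (by positivity)
  have hrat : volume {α : ℝ | ¬ Irrational α} = 0 := by
    have : {α : ℝ | ¬ Irrational α} = range ((↑) : ℚ → ℝ) := by
      ext α; simp [Irrational]
    rw [this]
    exact (countable_range _).measure_zero _
  refine measure_mono_null ?_ (measure_union_null hrat (measure_iUnion_null hK))
  intro α hα
  by_contra hcon
  simp only [mem_union, mem_ofPred_eq, mem_iUnion, not_or, not_not, not_exists] at hcon
  refine hα (isTypical_of_eventually hcon.1 ?_)
  obtain ⟨K, hKα⟩ := exists_nat_ge |α|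
  have := hcon.2 K
  rw [not_frequently] at this
  filter_upwards [this] with q hq
  by_contra h
  exact hq ⟨abs_le.1 hKα, not_le.1 h⟩

/-! ### Adding constants in the Whitney topology -/

/-- The function `U + t`. -/
def SmoothPeriodic.addConst (U : SmoothPeriodic) (t : ℝ) : SmoothPeriodic where
  toFun q := U.toFun q + t
  contDiff := U.contDiff.add contDiff_const
  periodic q := by simp only [U.periodic q]

theorem SmoothPeriodic.deriv_addConst (U : SmoothPeriodic) (t : ℝ) :
    deriv (U.addConst t).toFun = deriv U.toFun := by
  ext q
  exact deriv_add_const t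

theorem SmoothPeriodic.jet_addConst (U : SmoothPeriodic) (k : ℕ) (t q : ℝ) :
    (U.addConst t).jet k q =
      ((q : UnitAddCircle), fun i : Fin (k + 1) => iteratedDeriv (i : ℕ) U.toFun q +
        if i = 0 then t else 0) := by
  refine Prod.ext rfl (funext fun i => ?_)
  refine Fin.cases ?_ (fun j => ?_) i
  · simp [jet, addConst]
  · simp only [jet, Fin.val_succ, iteratedDeriv_succ', U.deriv_addConst]
    simp [Fin.succ_ne_zero]

theorem SmoothPeriodic.periodic_iteratedDeriv (U : SmoothPeriodic) (k : ℕ) :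
    Function.Periodic (iteratedDeriv k U.toFun) 1 := by
  intro q
  have h := congrFun (iteratedDeriv_comp_add_const k U.toFun 1) q
  rw [← h]
  congr 1
  exact funext U.periodic

theorem SmoothPeriodic.periodic_jet (U : SmoothPeriodic) (k : ℕ) :
    Function.Periodic (U.jet k) 1 := by
  intro q
  refine Prod.ext ?_ (funext fun i => U.periodic_iteratedDeriv i q)
  simp [jet]

/-- Adding constants is continuous for the Whitney topology, the circle being compact. -/
theorem SmoothPeriodic.continuous_addConst (U : SmoothPeriodic) : Continuous U.addConst := by
  refine continuous_generateFrom_iff.2 ?_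
  rintro _ ⟨k, O, hO, rfl⟩
  have hcont : Continuous fun p : ℝ × ℝ => (U.addConst p.1).jet k p.2 := by
    simp only [jet_addConst]
    refine Continuous.prodMk ?_ (continuous_pi fun i => ?_)
    · exact (AddCircle.continuous_mk' 1).comp continuous_snd
    · refine Continuous.add ?_ ?_
      · exact (U.contDiff.continuous_iteratedDeriv i (by exact_mod_cast le_top)).comp
          continuous_snd
      · split_ifs
        · exact continuous_fst
        · exact continuous_const
  have heq : U.addConst ⁻¹' {f : SmoothPeriodic | ∀ q : ℝ, f.jet k q ∈ O} =
      {t | ∀ q ∈ Icc (0 : ℝ) 1, (U.addConst t).jet k q ∈ O} := by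
    ext t
    refine ⟨fun h q _ => h q, fun h q => ?_⟩
    obtain ⟨y, hy, hqy⟩ := ((U.addConst t).periodic_jet k).exists_mem_Ico₀ one_pos q
    rw [hqy]
    exact h y (Ico_subset_Icc_self hy)
  rw [heq, isOpen_iff_mem_nhds]
  intro t ht
  exact isCompact_Icc.eventually_forall_of_forall_eventually fun q hq =>
    hcont.continuousAt.eventually (hO.mem_nhds (ht q hq))

theorem SmoothPeriodic.addConst_zero (U : SmoothPeriodic) : U.addConst 0 = U := by
  cases U
  simp [addConst]

theorem addConst_mem_omegaRev {U : SmoothPeriodic} (hU : U ∈ OmegaRev) {t : ℝ}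
    (ht : ∀ q, 0 < U.toFun q + t) : U.addConst t ∈ OmegaRev := by
  obtain ⟨-, hm, hM, hc⟩ := hU
  have h1 : ∀ m, IsLocalMin (U.addConst t).toFun m ↔ IsLocalMin U.toFun m := fun m => by
    simp [IsLocalMin, IsMinFilter, SmoothPeriodic.addConst]
  have h2 : ∀ m, IsLocalMax (U.addConst t).toFun m ↔ IsLocalMax U.toFun m := fun m => by
    simp [IsLocalMax, IsMaxFilter, SmoothPeriodic.addConst]
  refine ⟨ht, ?_, ?_, ?_⟩
  · simpa only [h1] using hm
  · simpa only [h2] using hM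
  · simpa only [U.deriv_addConst] using hc

/-- If `U + t` is nondegenerate for almost every small `t`, then `U` is a limit of nondegenerate
functions. -/
theorem dense_of_ae_addConst
    (h : ∀ U ∈ OmegaRev, ∃ ε > 0, volume {t ∈ Ioo (-ε) ε | ¬ IsNondegenerate (U.addConst t)} = 0) :
    Dense {U : OmegaRev | IsNondegenerate U.1} := by
  rw [dense_iff_inter_open]
  rintro _ ⟨W, hW, rfl⟩ ⟨U, hUW⟩
  obtain ⟨ε, hε, hnull⟩ := h U.1 U.2
  have hnhds : U.1.addConst ⁻¹' W ∩ Ioo (-ε) ε ∈ 𝓝 (0 : ℝ) := by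
    refine inter_mem (U.1.continuous_addConst.continuousAt.preimage_mem_nhds ?_)
      (Ioo_mem_nhds (by linarith) hε)
    rw [U.1.addConst_zero]
    exact hW.mem_nhds hUW
  obtain ⟨t, ⟨htW, ht⟩, hnd⟩ : ((U.1.addConst ⁻¹' W ∩ Ioo (-ε) ε) \
      {t ∈ Ioo (-ε) ε | ¬ IsNondegenerate (U.1.addConst t)}).Nonempty := by
    refine nonempty_of_measure_ne_zero (μ := volume) ?_
    rw [measure_sdiff_null hnull]
    exact (Measure.measure_pos_of_mem_nhds volume hnhds).ne'
  have hgood : IsNondegenerate (U.1.addConst t) := by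
    by_contra hcon
    exact hnd ⟨ht, hcon⟩
  exact ⟨⟨U.1.addConst t, hgood.mem_omegaRev⟩, htW, hgood⟩

/-! ### Curvature and nondegeneracy in terms of the derivatives of `F₁` -/

theorem SmoothPeriodic.continuous (U : SmoothPeriodic) : Continuous U.toFun := U.contDiff.continuous

theorem SmoothPeriodic.exists_min (U : SmoothPeriodic) :
    ∃ m, U.toFun m = c₂ U.toFun ∧ ∀ q, c₂ U.toFun ≤ U.toFun q := by
  obtain ⟨m, hm, hmin⟩ := isCompact_Icc.exists_isMinOn (nonempty_Icc.2 zero_le_one)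
    (U.continuous.continuousOn (s := Icc (0 : ℝ) 1))
  have heq : c₂ U.toFun = U.toFun m :=
    IsLeast.csInf_eq ⟨mem_image_of_mem _ hm, by rintro _ ⟨q, hq, rfl⟩; exact hmin hq⟩
  refine ⟨m, heq.symm, fun q => ?_⟩
  obtain ⟨y, hy, hqy⟩ := U.periodic.exists_mem_Ico₀ one_pos q
  rw [hqy, heq]
  exact hmin (Ico_subset_Icc_self hy)

theorem SmoothPeriodic.exists_max (U : SmoothPeriodic) :
    ∃ M, U.toFun M = c₁ U.toFun ∧ ∀ q, U.toFun q ≤ c₁ U.toFun := by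
  obtain ⟨m, hm, hmax⟩ := isCompact_Icc.exists_isMaxOn (nonempty_Icc.2 zero_le_one)
    (U.continuous.continuousOn (s := Icc (0 : ℝ) 1))
  have heq : c₁ U.toFun = U.toFun m :=
    IsGreatest.csSup_eq ⟨mem_image_of_mem _ hm, by rintro _ ⟨q, hq, rfl⟩; exact hmax hq⟩
  refine ⟨m, heq.symm, fun q => ?_⟩
  obtain ⟨y, hy, hqy⟩ := U.periodic.exists_mem_Ico₀ one_pos q
  rw [hqy, heq]
  exact hmax (Ico_subset_Icc_self hy)

theorem SmoothPeriodic.c₁_addConst (U : SmoothPeriodic) (t : ℝ) :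
    c₁ (U.addConst t).toFun = c₁ U.toFun + t := by
  obtain ⟨M, hM, hle⟩ := U.exists_max
  obtain ⟨M', hM', hle'⟩ := (U.addConst t).exists_max
  have h1 : U.toFun M' + t = _ := hM'
  have h2 : U.toFun M + t ≤ _ := hle' M
  have := hle M'
  linarith

theorem SmoothPeriodic.c₂_addConst (U : SmoothPeriodic) (t : ℝ) :
    c₂ (U.addConst t).toFun = c₂ U.toFun + t := by
  obtain ⟨M, hM, hle⟩ := U.exists_min
  obtain ⟨M', hM', hle'⟩ := (U.addConst t).exists_min
  have h1 : U.toFun M' + t = _ := hM'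
  have h2 : _ ≤ U.toFun M + t := hle' M
  have := hle M'
  linarith

/-- The restriction to the superlevel set may be dropped, since `√` vanishes on negative
numbers. -/
theorem F₁_eq_intervalIntegral (U : ℝ → ℝ) (c : ℝ) :
    F₁ U c = ∫ q in (0 : ℝ)..1, Real.sqrt (U q - c) := by
  rw [intervalIntegral.integral_of_le zero_le_one, ← integral_Ico_eq_integral_Ioc, F₁]
  symm
  refine setIntegral_eq_of_subset_of_forall_sdiff_eq_zero measurableSet_Ico (fun q hq => hq.1) ?_
  rintro q ⟨hq, hq'⟩
  refine Real.sqrt_eq_zero_of_nonpos ?_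
  by_contra hcon
  exact hq' ⟨hq, by linarith [not_le.1 hcon]⟩

theorem F₁_addConst (U : SmoothPeriodic) (t c : ℝ) :
    F₁ (U.addConst t).toFun c = F₁ U.toFun (c - t) := by
  simp only [F₁_eq_intervalIntegral, SmoothPeriodic.addConst]
  refine intervalIntegral.integral_congr fun q _ => ?_
  show √(_) = √(_)
  congr 1; ring

theorem F₁_c₂_pos {U : SmoothPeriodic} (h : c₂ U.toFun < c₁ U.toFun) :
    0 < F₁ U.toFun (c₂ U.toFun) := by
  obtain ⟨M, hM, -⟩ := U.exists_max
  have hcont : Continuous fun q => Real.sqrt (U.toFun q - c₂ U.toFun) :=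
    (U.continuous.sub continuous_const).sqrt
  have hper : Function.Periodic (fun q => Real.sqrt (U.toFun q - c₂ U.toFun)) 1 := fun q => by
    simp only [U.periodic q]
  rw [F₁_eq_intervalIntegral]
  have h1 := hper.intervalIntegral_add_eq 0 M
  rw [zero_add] at h1
  rw [h1]
  refine intervalIntegral.integral_pos (by linarith) hcont.continuousOn
    (fun q _ => Real.sqrt_nonneg _) ⟨M, ⟨le_rfl, by linarith⟩, Real.sqrt_pos.2 ?_⟩
  rw [hM]; linarith

section D

variable {U : ℝ → ℝ} {f g : ℝ → ℝ} {c d : ℝ}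

theorem uniqueDiffWithinAt_of_mem (hc : c ∈ Ioc 0 (c₁ U)) :
    UniqueDiffWithinAt ℝ (Icc 0 (c₁ U)) c :=
  uniqueDiffOn_Icc (hc.1.trans_le hc.2) c (Ioc_subset_Icc_self hc)

theorem D_eq (hc : c ∈ Ioc 0 (c₁ U)) (h : HasDerivWithinAt f d (Iic (c₁ U)) c) :
    D U f c = d :=
  (h.mono fun _ hx => hx.2).derivWithin (uniqueDiffWithinAt_of_mem hc)

theorem D_congr (h : f =ᶠ[𝓝[Iic (c₁ U)] c] g) (hc : c ≤ c₁ U) : D U f c = D U g c :=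
  (h.filter_mono (nhdsWithin_mono _ fun _ hx => hx.2)).derivWithin_eq (h.self_of_nhdsWithin hc)

theorem Ioc_mem_nhdsWithin_Iic {a b : ℝ} (h : a < c) : Ioc a b ∈ 𝓝[Iic b] c := by
  rw [← Ioi_inter_Iic, inter_comm]
  exact inter_mem_nhdsWithin _ (Ioi_mem_nhds h)

theorem hasDerivAt_F₂ (hc : 0 < c) : HasDerivAt F₂ (1 / (2 * √c)) c :=
  Real.hasDerivAt_sqrt hc.ne'

theorem D_F₂ (hc : c ∈ Ioc 0 (c₁ U)) : D U F₂ c = 1 / (2 * √c) :=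
  D_eq hc (hasDerivAt_F₂ hc.1).hasDerivWithinAt

theorem D_D_F₂ (hc : c ∈ Ioc 0 (c₁ U)) : D U (D U F₂) c = -1 / (4 * c * √c) := by
  have h : D U F₂ =ᶠ[𝓝[Iic (c₁ U)] c] fun x => 1 / (2 * √x) := by
    filter_upwards [Ioc_mem_nhdsWithin_Iic hc.1] with x hx using D_F₂ hx
  rw [D_congr h hc.2]
  refine D_eq hc (HasDerivAt.hasDerivWithinAt ?_)
  have hs : 0 < √c := Real.sqrt_pos.2 hc.1
  have h2 := ((Real.hasDerivAt_sqrt hc.1.ne').const_mul 2).inv (by positivity)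
  simp only [one_div]
  refine HasDerivAt.congr_deriv h2 ?_
  have h3 : √c ^ 2 = c := Real.sq_sqrt hc.1.le
  have := hc.1
  field_simp
  rw [h3]; ring

end D

/-- `G = -F₁'`, `G₁ = -F₁''` and `G₂ = -F₁'''` on `(c₂, c₁)`, where `F₁` is `C²` up to the
endpoint `c₁` and `G` is positive. -/
structure IsJet (U G G₁ G₂ : ℝ → ℝ) : Prop where
  deriv₀ : ∀ c ∈ Ioo (c₂ U) (c₁ U), HasDerivAt (F₁ U) (-G c) c
  deriv₁ : ∀ c ∈ Ioo (c₂ U) (c₁ U), HasDerivAt G (G₁ c) c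
  deriv₂ : ∀ c ∈ Ioo (c₂ U) (c₁ U), HasDerivAt G₁ (G₂ c) c
  endpoint₀ : HasDerivWithinAt (F₁ U) (-G (c₁ U)) (Iic (c₁ U)) (c₁ U)
  endpoint₁ : HasDerivWithinAt G (G₁ (c₁ U)) (Iic (c₁ U)) (c₁ U)
  endpoint₂ : ContinuousWithinAt G₁ (Iic (c₁ U)) (c₁ U)
  pos : ∀ c ∈ Ioc (c₂ U) (c₁ U), 0 < G c

theorem IsJet.addConst {U : SmoothPeriodic} {G G₁ G₂ : ℝ → ℝ} (h : IsJet U.toFun G G₁ G₂) (t : ℝ) :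
    IsJet (U.addConst t).toFun (fun c => G (c - t)) (fun c => G₁ (c - t))
      (fun c => G₂ (c - t)) := by
  have hF : F₁ (U.addConst t).toFun = fun c => F₁ U.toFun (c - t) := funext (F₁_addConst U t)
  have hmaps : MapsTo (fun c => c - t) (Iic (c₁ U.toFun + t)) (Iic (c₁ U.toFun)) := fun c hc => by
    simp only [mem_Iic] at *; linarith
  have hsub : ∀ x, HasDerivAt (fun c : ℝ => c - t) 1 x := fun x => (hasDerivAt_id x).sub_const t
  have hend : c₁ U.toFun + t - t = c₁ U.toFun := by ring
  constructor
  all_goals simp only [hF, U.c₁_addConst, U.c₂_addConst]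
  · exact fun c hc => (h.deriv₀ (c - t) ⟨by linarith [hc.1], by linarith [hc.2]⟩).comp_sub_const c t
  · exact fun c hc => (h.deriv₁ (c - t) ⟨by linarith [hc.1], by linarith [hc.2]⟩).comp_sub_const c t
  · exact fun c hc => (h.deriv₂ (c - t) ⟨by linarith [hc.1], by linarith [hc.2]⟩).comp_sub_const c t
  · have h0 := h.endpoint₀
    rw [← hend] at h0
    have := HasDerivWithinAt.comp (c₁ U.toFun + t) h0 (hsub _).hasDerivWithinAt
      (by simpa only [hend] using hmaps)
    exact this.congr_deriv (by simp [hend])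
  · have h0 := h.endpoint₁
    rw [← hend] at h0
    have := HasDerivWithinAt.comp (c₁ U.toFun + t) h0 (hsub _).hasDerivWithinAt
      (by simpa only [hend] using hmaps)
    exact this.congr_deriv (by simp [hend])
  · have h0 := h.endpoint₂
    rw [← hend] at h0
    exact ContinuousWithinAt.comp h0 (hsub _).continuousAt.continuousWithinAt
      (by simpa only [hend] using hmaps)
  · exact fun c hc => h.pos (c - t) ⟨by linarith [hc.1], by linarith [hc.2]⟩

section Jet

variable {U G G₁ G₂ : ℝ → ℝ} {c : ℝ}

/-- The positive factor by which the curvature differs from `G + 2 c G₁`. -/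
noncomputable def curvatureFactor (G : ℝ → ℝ) (c : ℝ) : ℝ :=
  1 / (4 * c * √c) / ((-G c) ^ 2 + (1 / (2 * √c)) ^ 2) ^ (3 / 2 : ℝ)

theorem curvatureFactor_pos (hc : 0 < c) : 0 < curvatureFactor G c := by
  unfold curvatureFactor
  have hs : 0 < √c := Real.sqrt_pos.2 hc
  positivity

theorem differentiableAt_curvatureFactor (hc : 0 < c) (hG : DifferentiableAt ℝ G c) :
    DifferentiableAt ℝ (curvatureFactor G) c := by
  have hs : 0 < √c := Real.sqrt_pos.2 hc
  have hsq : DifferentiableAt ℝ (fun x : ℝ => √x) c :=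
    (Real.hasDerivAt_sqrt hc.ne').differentiableAt
  have hd : (-G c) ^ 2 + (1 / (2 * √c)) ^ 2 ≠ 0 := by positivity
  unfold curvatureFactor
  refine DifferentiableAt.div ?_ ?_ (by positivity)
  · exact (differentiableAt_const _).div ((differentiableAt_fun_id.const_mul 4).mul hsq)
      (by positivity)
  · refine DifferentiableAt.rpow_const (DifferentiableAt.add (hG.neg.pow 2) (DifferentiableAt.pow
      ((differentiableAt_const _).div (hsq.const_mul 2) (by positivity)) 2)) (Or.inl hd)

theorem IsJet.D_F₁ (h : IsJet U G G₁ G₂) (h0 : 0 < c₂ U) (hc : c ∈ Ioc (c₂ U) (c₁ U)) :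
    D U (F₁ U) c = -G c := by
  refine D_eq ⟨h0.trans hc.1, hc.2⟩ ?_
  rcases hc.2.lt_or_eq with hlt | rfl
  · exact (h.deriv₀ c ⟨hc.1, hlt⟩).hasDerivWithinAt
  · exact h.endpoint₀

theorem IsJet.D_D_F₁ (h : IsJet U G G₁ G₂) (h0 : 0 < c₂ U) (hc : c ∈ Ioc (c₂ U) (c₁ U)) :
    D U (D U (F₁ U)) c = -G₁ c := by
  have heq : D U (F₁ U) =ᶠ[𝓝[Iic (c₁ U)] c] fun x => -G x := by
    filter_upwards [Ioc_mem_nhdsWithin_Iic hc.1] with x hx using h.D_F₁ h0 hx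
  rw [D_congr heq hc.2]
  refine D_eq ⟨h0.trans hc.1, hc.2⟩ ?_
  rcases hc.2.lt_or_eq with hlt | rfl
  · exact (h.deriv₁ c ⟨hc.1, hlt⟩).neg.hasDerivWithinAt
  · exact h.endpoint₁.neg

theorem IsJet.curvature_eq (h : IsJet U G G₁ G₂) (h0 : 0 < c₂ U) (hc : c ∈ Ioc (c₂ U) (c₁ U)) :
    curvature U c = curvatureFactor G c * (G c + 2 * c * G₁ c) := by
  have hc0 : c ∈ Ioc 0 (c₁ U) := ⟨h0.trans hc.1, hc.2⟩
  have hs : 0 < √c := Real.sqrt_pos.2 hc0.1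
  rw [curvature, h.D_F₁ h0 hc, h.D_D_F₁ h0 hc, D_F₂ hc0, D_D_F₂ hc0, curvatureFactor,
    div_mul_eq_mul_div]
  have := hc0.1
  field_simp
  ring

theorem IsJet.curvature_eq_zero_iff (h : IsJet U G G₁ G₂) (h0 : 0 < c₂ U)
    (hc : c ∈ Ioc (c₂ U) (c₁ U)) : curvature U c = 0 ↔ G c + 2 * c * G₁ c = 0 := by
  rw [h.curvature_eq h0 hc, mul_eq_zero, or_iff_right (curvatureFactor_pos (h0.trans hc.1)).ne']

theorem IsJet.hasDerivAt_numerator (h : IsJet U G G₁ G₂) (hc : c ∈ Ioo (c₂ U) (c₁ U)) :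
    HasDerivAt (fun x => G x + 2 * x * G₁ x) (3 * G₁ c + 2 * c * G₂ c) c := by
  have := (h.deriv₁ c hc).add (((hasDerivAt_id c).const_mul 2).mul (h.deriv₂ c hc))
  exact this.congr_deriv (by simp only [id]; ring)

theorem IsJet.D_curvature (h : IsJet U G G₁ G₂) (h0 : 0 < c₂ U) (hc : c ∈ Ioo (c₂ U) (c₁ U))
    (hz : G c + 2 * c * G₁ c = 0) :
    D U (curvature U) c = curvatureFactor G c * (3 * G₁ c + 2 * c * G₂ c) := by
  have heq : curvature U =ᶠ[𝓝[Iic (c₁ U)] c]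
      fun x => curvatureFactor G x * (G x + 2 * x * G₁ x) := by
    filter_upwards [Ioc_mem_nhdsWithin_Iic hc.1] with x hx using h.curvature_eq h0 hx
  rw [D_congr heq hc.2.le]
  refine D_eq ⟨h0.trans hc.1, hc.2.le⟩ (HasDerivAt.hasDerivWithinAt ?_)
  have hE := (differentiableAt_curvatureFactor (h0.trans hc.1)
    (h.deriv₁ c hc).differentiableAt).hasDerivAt
  have := hE.mul (h.hasDerivAt_numerator hc)
  exact this.congr_deriv (by simp [hz])

/-- Simple zeros of the curvature are isolated, so there are finitely many of them as soon as
they accumulate at neither end of `(c₂, c₁]`. -/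
theorem IsJet.finite_zeros (h : IsJet U G G₁ G₂) {ε : ℝ} (hε : 0 < ε)
    (hmin : ∀ c ∈ Ioo (c₂ U) (c₂ U + ε), G c + 2 * c * G₁ c < 0)
    (hmax : G (c₁ U) + 2 * c₁ U * G₁ (c₁ U) ≠ 0)
    (hsimple : ∀ c ∈ Ioo (c₂ U) (c₁ U), G c + 2 * c * G₁ c = 0 → 3 * G₁ c + 2 * c * G₂ c ≠ 0) :
    {c | c ∈ Ioc (c₂ U) (c₁ U) ∧ G c + 2 * c * G₁ c = 0}.Finite := by
  by_contra hinf
  obtain ⟨x, hx, hacc⟩ := Set.Infinite.exists_accPt_of_subset_isCompact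
    (K := Icc (c₂ U + ε) (c₁ U)) hinf isCompact_Icc (by
      rintro c ⟨hc, hz⟩
      refine ⟨?_, hc.2⟩
      by_contra hcon
      exact (hmin c ⟨hc.1, not_le.1 hcon⟩).ne hz)
  have hx2 : c₂ U < x := by linarith [hx.1]
  have hfreq := accPt_iff_frequently_nhdsNE.1 hacc
  rcases hx.2.lt_or_eq with hlt | hxe
  · have hd := h.hasDerivAt_numerator ⟨hx2, hlt⟩
    have hx0 : G x + 2 * x * G₁ x = 0 := by
      by_contra hne
      have := (hd.continuousAt.eventually_ne hne).filter_mono (nhdsWithin_le_nhds (s := {x}ᶜ))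
      exact hfreq (this.mono fun y hy hy' => hy hy'.2)
    have := hd.eventually_ne (c := 0) (hsimple x ⟨hx2, hlt⟩ hx0)
    exact hfreq (this.mono fun y hy hy' => hy hy'.2)
  · have hcw : ContinuousWithinAt (fun y => G y + 2 * y * G₁ y) (Iic (c₁ U)) (c₁ U) :=
      h.endpoint₁.continuousWithinAt.add
        ((continuousWithinAt_const.mul continuousWithinAt_id).mul h.endpoint₂)
    have := hcw.eventually_ne hmax
    rw [eventually_nhdsWithin_iff] at this
    rw [hxe] at hfreq
    exact hfreq ((this.filter_mono nhdsWithin_le_nhds).mono fun y hy hy' => hy hy'.1.2 hy'.2)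

end Jet

/-- Nondegeneracy in terms of the derivatives of `F₁`. -/
theorem IsJet.isNondegenerate {U : SmoothPeriodic} {G G₁ G₂ : ℝ → ℝ} (hU : U ∈ OmegaRev)
    (h : IsJet U.toFun G G₁ G₂) (h0 : 0 < c₂ U.toFun) (h01 : c₂ U.toFun < c₁ U.toFun)
    (hlow : ∀ c ∈ Ioo 0 (c₂ U.toFun), curvature U.toFun c ≠ 0)
    {ε : ℝ} (hε : 0 < ε)
    (hmin : ∀ c ∈ Ioo (c₂ U.toFun) (c₂ U.toFun + ε), G c + 2 * c * G₁ c < 0)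
    (hmax : G (c₁ U.toFun) + 2 * c₁ U.toFun * G₁ (c₁ U.toFun) ≠ 0)
    (hsimple : ∀ c ∈ Ioo (c₂ U.toFun) (c₁ U.toFun), G c + 2 * c * G₁ c = 0 →
      3 * G₁ c + 2 * c * G₂ c ≠ 0 ∧ IsTypical (1 / (2 * √c) / -G c))
    (htmax : IsTypical (1 / (2 * √(c₁ U.toFun)) / -G (c₁ U.toFun)))
    (htmin : IsTypical (√(c₂ U.toFun) / F₁ U.toFun (c₂ U.toFun))) : IsNondegenerate U := by
  have hmem : ∀ c ∈ Ioc (c₂ U.toFun) (c₁ U.toFun), G c + 2 * c * G₁ c = 0 →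
      c ∈ Ioo (c₂ U.toFun) (c₁ U.toFun) := by
    intro c hc hz
    refine ⟨hc.1, hc.2.lt_of_ne ?_⟩
    rintro rfl
    exact hmax hz
  have hend : c₁ U.toFun ∈ Ioc (c₂ U.toFun) (c₁ U.toFun) := ⟨h01, le_rfl⟩
  refine ⟨hU, ?_, ?_, ?_, ?_, htmin⟩
  · refine (h.finite_zeros hε hmin hmax fun c hc hz => (hsimple c hc hz).1).subset ?_
    rintro c ⟨hc, hz⟩
    exact ⟨hc, (h.curvature_eq_zero_iff h0 hc).1 hz⟩
  · intro c hc hz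
    rw [h.curvature_eq_zero_iff h0 hc] at hz
    have hc' := hmem c hc hz
    rw [h.D_curvature h0 hc' hz]
    exact mul_ne_zero (curvatureFactor_pos (h0.trans hc.1)).ne' (hsimple c hc' hz).1
  · rintro c (hc | hc) hz
    · exact absurd hz (hlow c hc)
    · rw [h.curvature_eq_zero_iff h0 hc] at hz
      rw [h.D_F₁ h0 hc, D_F₂ ⟨h0.trans hc.1, hc.2⟩]
      exact (hsimple c (hmem c hc hz) hz).2
  · rw [h.D_F₁ h0 hend, D_F₂ ⟨h0.trans h01, le_rfl⟩]
    exact htmax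

/-! ### Almost every constant works -/

/-- The value of `t` for which the curvature belonging to `U + t` vanishes at `x + t`. -/
noncomputable def zeroShift (G G₁ : ℝ → ℝ) (x : ℝ) : ℝ := -x - G x / (2 * G₁ x)

/-- The square of the slope `F₂' / F₁'` belonging to `U + t` at `x + t`, for `t = zeroShift x`. -/
noncomputable def slopeSq (G G₁ : ℝ → ℝ) (x : ℝ) : ℝ := -G₁ x / (2 * G x ^ 3)

section

variable {U G G₁ G₂ : ℝ → ℝ} {x : ℝ}

theorem IsJet.hasDerivAt_zeroShift (h : IsJet U G G₁ G₂) (hx : x ∈ Ioo (c₂ U) (c₁ U))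
    (h1 : G₁ x ≠ 0) :
    HasDerivAt (zeroShift G G₁) (-(3 / 2) + G x * G₂ x / (2 * G₁ x ^ 2)) x := by
  have := (hasDerivAt_id x).neg.sub ((h.deriv₁ x hx).div ((h.deriv₂ x hx).const_mul 2)
    (mul_ne_zero two_ne_zero h1))
  refine HasDerivAt.congr_deriv this ?_
  field_simp
  ring

theorem IsJet.hasDerivAt_slopeSq (h : IsJet U G G₁ G₂) (hx : x ∈ Ioo (c₂ U) (c₁ U)) :
    HasDerivAt (slopeSq G G₁) ((3 * G₁ x ^ 2 - G x * G₂ x) / (2 * G x ^ 4)) x := by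
  have hpos := h.pos x ⟨hx.1, hx.2.le⟩
  have := (h.deriv₂ x hx).neg.div (((h.deriv₁ x hx).pow 3).const_mul 2)
    (mul_ne_zero two_ne_zero (pow_ne_zero 3 hpos.ne'))
  refine HasDerivAt.congr_deriv this ?_
  simp only [Pi.neg_apply, Pi.pow_apply]
  field_simp
  push_cast
  ring

/-- For almost every `t`, all zeros `x + t` of the curvature belonging to `U + t` are simple, and
the curve has a typical slope there. The first property is Sard's theorem. For the second one
notes that the derivatives of `zeroShift` and `slopeSq` vanish at the same points: along a fixed
curve the slope is stationary at a zero of the curvature, so that `x` acts on it only through `t`.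
Hence a null set of slopes comes from a null set of `t`. -/
theorem IsJet.volume_image_zeroShift (h : IsJet U G G₁ G₂) :
    volume (zeroShift G G₁ '' {x ∈ Ioo (c₂ U) (c₁ U) | G₁ x < 0 ∧
      (-(3 / 2) + G x * G₂ x / (2 * G₁ x ^ 2) = 0 ∨ ¬ IsTypical (-√(slopeSq G G₁ x)))}) = 0 := by
  have hsub : {x ∈ Ioo (c₂ U) (c₁ U) | G₁ x < 0 ∧
      (-(3 / 2) + G x * G₂ x / (2 * G₁ x ^ 2) = 0 ∨ ¬ IsTypical (-√(slopeSq G G₁ x)))} =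
      {x ∈ Ioo (c₂ U) (c₁ U) | G₁ x < 0 ∧ -(3 / 2) + G x * G₂ x / (2 * G₁ x ^ 2) = 0} ∪
      {x ∈ Ioo (c₂ U) (c₁ U) | G₁ x < 0 ∧ ¬ IsTypical (-√(slopeSq G G₁ x))} := by
    ext x; simp only [mem_ofPred_eq, mem_union]; tauto
  rw [hsub, image_union]
  refine measure_union_null ?_ ?_
  · refine volume_image_eq_zero_of_volume_image_eq_zero (Q := fun _ => 0) (Q' := fun _ => 0)
      (fun x hx => h.hasDerivAt_zeroShift hx.1 hx.2.1.ne) (fun x _ => hasDerivAt_const x 0)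
      (fun x hx _ => hx.2.2) ?_
    exact measure_mono_null (by rintro _ ⟨x, -, rfl⟩; rfl) (measure_singleton (0 : ℝ))
  · refine volume_image_eq_zero_of_volume_image_eq_zero
      (fun x hx => h.hasDerivAt_zeroShift hx.1 hx.2.1.ne) (fun x hx => h.hasDerivAt_slopeSq hx.1)
      (fun x hx hz => ?_) ?_
    · have hpos := h.pos x ⟨hx.1.1, hx.1.2.le⟩
      have h1 := hx.2.1.ne
      rw [div_eq_zero_iff, or_iff_left (by positivity)] at hz
      field_simp
      linarith
    · have hsq : volume ((fun α : ℝ => α ^ 2) '' {α | ¬ IsTypical α}) = 0 :=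
        addHaar_image_eq_zero_of_differentiableOn_of_addHaar_eq_zero volume
          (fun x _ => (differentiableAt_fun_id.pow 2).differentiableWithinAt) volume_not_isTypical
      refine measure_mono_null ?_ hsq
      rintro _ ⟨x, hx, rfl⟩
      have hpos := h.pos x ⟨hx.1.1, hx.1.2.le⟩
      refine ⟨_, hx.2.2, ?_⟩
      simp only [neg_sq]
      refine Real.sq_sqrt ?_
      have := hx.2.1
      unfold slopeSq
      have : 0 < -G₁ x := by linarith
      positivity

/-- The slope `a √(c + t)` is typical for almost every `t`, provided that `a ≠ 0`. -/
theorem volume_not_isTypical_mul_sqrt {a : ℝ} (ha : a ≠ 0) (c : ℝ) :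
    volume {t | 0 < c + t ∧ ¬ IsTypical (a * √(c + t))} = 0 := by
  refine volume_eq_zero_of_volume_image_eq_zero (f := fun t => a * √(c + t))
    (f' := fun t => a * (1 / (2 * √(c + t)))) (fun t ht => ?_) (fun t ht => ?_)
    (measure_mono_null ?_ volume_not_isTypical)
  · have := ((hasDerivAt_id t).const_add c).sqrt ht.1.ne'
    exact (this.const_mul a).hasDerivWithinAt
  · have : 0 < √(c + t) := Real.sqrt_pos.2 ht.1
    positivity
  · rintro _ ⟨t, ht, rfl⟩
    exact ht.2

theorem volume_not_isTypical_div_sqrt {a : ℝ} (ha : a ≠ 0) (c : ℝ) :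
    volume {t | 0 < c + t ∧ ¬ IsTypical (1 / (2 * √(c + t)) / a)} = 0 := by
  refine volume_eq_zero_of_volume_image_eq_zero (f := fun t => 1 / (2 * √(c + t)) / a)
    (f' := fun t => -1 / (4 * (c + t) * √(c + t)) / a) (fun t ht => ?_) (fun t ht => ?_)
    (measure_mono_null ?_ volume_not_isTypical)
  · have hs : 0 < √(c + t) := Real.sqrt_pos.2 ht.1
    have hct := ht.1
    have h2 := (((((hasDerivAt_id t).const_add c).sqrt ht.1.ne').const_mul 2).inv
      (by simp only [id]; positivity)).div_const a
    simp only [one_div]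
    refine (HasDerivAt.congr_deriv h2 ?_).hasDerivWithinAt
    have h3 : √(c + t) ^ 2 = c + t := Real.sq_sqrt hct.le
    simp only [id]
    field_simp
    rw [h3]; ring
  · have : 0 < √(c + t) := Real.sqrt_pos.2 ht.1
    have := ht.1
    exact div_ne_zero (div_ne_zero (by norm_num) (by positivity)) ha
  · rintro _ ⟨t, ht, rfl⟩
    exact ht.2

end

theorem IsJet.volume_not_isNondegenerate {U : SmoothPeriodic} {G G₁ G₂ : ℝ → ℝ} (hU : U ∈ OmegaRev)
    (h : IsJet U.toFun G G₁ G₂) (h0 : 0 < c₂ U.toFun) (h01 : c₂ U.toFun < c₁ U.toFun)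
    (hlow : ∀ V ∈ OmegaRev, ∀ c ∈ Ioo 0 (c₂ V.toFun), curvature V.toFun c ≠ 0)
    {ε : ℝ} (hε : 0 < ε) (hεb : c₂ U.toFun + ε ≤ c₁ U.toFun)
    (hmin : ∀ c ∈ Ioo (c₂ U.toFun) (c₂ U.toFun + ε), G c + c₂ U.toFun * G₁ c < 0) :
    volume {t ∈ Ioo (-(c₂ U.toFun / 2)) (c₂ U.toFun / 2) | ¬ IsNondegenerate (U.addConst t)} =
      0 := by
  set a := c₂ U.toFun with ha
  set b := c₁ U.toFun with hb
  have hGb : 0 < G b := h.pos b ⟨h01, le_rfl⟩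
  have hF := F₁_c₂_pos h01
  rw [← ha] at hF
  refine measure_mono_null ?_ (measure_union_null (measure_union_null h.volume_image_zeroShift
    (measure_singleton (zeroShift G G₁ b))) (measure_union_null
    (volume_not_isTypical_div_sqrt (neg_ne_zero.2 hGb.ne') b)
    (volume_not_isTypical_mul_sqrt (inv_ne_zero hF.ne') a)))
  rintro t ⟨ht, hnd⟩
  by_contra hcon
  simp only [mem_union, not_or, mem_image, not_exists, mem_singleton_iff, mem_ofPred_eq,
    not_and, not_not] at hcon
  obtain ⟨⟨hz, hbt⟩, htmax, htmin⟩ := hcon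
  have hat : 0 < a + t := by linarith [ht.1]
  obtain ⟨-, -, hle⟩ := U.exists_min
  have hV : U.addConst t ∈ OmegaRev :=
    addConst_mem_omegaRev hU fun q => by have := hle q; linarith
  have hc₁ : c₁ (U.addConst t).toFun = b + t := U.c₁_addConst t
  have hc₂ : c₂ (U.addConst t).toFun = a + t := U.c₂_addConst t
  have hlow' := hlow _ hV
  -- the numerator of the curvature can only vanish where `G₁ < 0`
  have hnum : ∀ x, a < x → 0 < G x → G x + 2 * (x + t) * G₁ x = 0 →
      G₁ x < 0 ∧ zeroShift G G₁ x = t := by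
    intro x hx hGx hzx
    have hxt : 0 < x + t := by linarith
    have hneg : G₁ x < 0 := by
      by_contra hcon
      have := mul_nonneg (mul_nonneg two_pos.le hxt.le) (not_lt.1 hcon)
      linarith
    refine ⟨hneg, ?_⟩
    have := hneg.ne
    unfold zeroShift
    field_simp
    linarith
  refine hnd ((h.addConst t).isNondegenerate hV (hc₂ ▸ hat) (by rw [hc₁, hc₂]; linarith) hlow'
    hε ?_ ?_ ?_ ?_ ?_)
  · rw [hc₂]
    intro c hc
    have hx := hmin (c - t) ⟨by linarith [hc.1], by linarith [hc.2]⟩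
    by_cases hG : G₁ (c - t) < 0
    · have : 2 * c * G₁ (c - t) ≤ a * G₁ (c - t) :=
        mul_le_mul_of_nonpos_right (by linarith [hc.1, ht.1]) hG.le
      linarith
    · have h1 := mul_nonneg h0.le (not_lt.1 hG)
      have := h.pos (c - t) ⟨by linarith [hc.1], by linarith [hc.2]⟩
      linarith
  · rw [hc₁, add_sub_cancel_right]
    intro hcon
    exact hbt (hnum b h01 hGb hcon).2.symm
  · rw [hc₁, hc₂]
    intro c hc hzc
    have hx : c - t ∈ Ioo a b := ⟨by linarith [hc.1], by linarith [hc.2]⟩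
    have hpos := h.pos _ ⟨hx.1, hx.2.le⟩
    have hzc' : G (c - t) + 2 * (c - t + t) * G₁ (c - t) = 0 := by
      rw [sub_add_cancel]; exact hzc
    obtain ⟨hneg, hshift⟩ := hnum _ hx.1 hpos hzc'
    have hc0 : 0 < c := hat.trans hc.1
    have hGeq : G (c - t) = -(2 * c * G₁ (c - t)) := by linarith
    have hne := hneg.ne
    have hs : 0 < √c := Real.sqrt_pos.2 hc0
    by_contra hcon
    refine hz (c - t) ⟨hx, hneg, ?_⟩ hshift
    by_cases hzero : 3 * G₁ (c - t) + 2 * c * G₂ (c - t) = 0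
    · left
      rw [hGeq]
      field_simp
      linarith
    · right
      convert fun htyp => hcon ⟨hzero, htyp⟩ using 2
      have hsq : slopeSq G G₁ (c - t) = (1 / (2 * √c * G (c - t))) ^ 2 := by
        rw [div_pow, mul_pow, mul_pow, Real.sq_sqrt hc0.le, slopeSq, one_pow, div_eq_div_iff
          (by positivity) (by positivity)]
        linear_combination (-2 * G (c - t) ^ 2) * hGeq
      rw [hsq, Real.sqrt_sq (by positivity)]
      field_simp
  · rw [hc₁, add_sub_cancel_right]
    exact htmax (by linarith)
  · rw [hc₂, F₁_addConst, add_sub_cancel_right]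
    have := htmin hat
    rwa [inv_mul_eq_div] at this

/-! ### Integrals depending on a parameter -/

theorem continuousOn_mul_comp_mul {φ w σ : ℝ → ℝ} {Y a b r : ℝ}
    (hφ : ContinuousOn φ (Ioo (-Y) Y)) (hw : Continuous w) (hσ : Continuous σ)
    (hσ1 : ∀ θ ∈ uIcc a b, |σ θ| ≤ 1) (hr : |r| < Y) :
    ContinuousOn (fun θ => w θ * φ (r * σ θ)) (uIcc a b) := by
  refine hw.continuousOn.mul (hφ.comp (continuous_const.mul hσ).continuousOn fun θ hθ => ?_)
  rw [mem_Ioo, ← abs_lt, abs_mul]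
  exact (mul_le_of_le_one_right (abs_nonneg _) (hσ1 θ hθ)).trans_lt hr

/-- Differentiation of `∫ w(θ) φ(r σ(θ)) dθ` in `r`. -/
theorem hasDerivAt_integral_mul_comp_mul {φ φ' w σ : ℝ → ℝ} {Y a b r : ℝ}
    (hφ : ∀ y ∈ Ioo (-Y) Y, HasDerivAt φ (φ' y) y) (hφ' : ContinuousOn φ' (Ioo (-Y) Y))
    (hw : Continuous w) (hσ : Continuous σ) (hσ1 : ∀ θ ∈ uIcc a b, |σ θ| ≤ 1) (hr : |r| < Y) :
    HasDerivAt (fun r => ∫ θ in a..b, w θ * φ (r * σ θ))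
      (∫ θ in a..b, w θ * σ θ * φ' (r * σ θ)) r := by
  obtain ⟨ρ, hrρ, hρY⟩ := exists_between hr
  have hφc : ContinuousOn φ (Ioo (-Y) Y) := fun y hy => (hφ y hy).continuousAt.continuousWithinAt
  have hsub : Icc (-ρ) ρ ⊆ Ioo (-Y) Y := fun y hy => ⟨by linarith [hy.1], by linarith [hy.2]⟩
  obtain ⟨C, hC⟩ := isCompact_Icc.exists_bound_of_continuousOn (hφ'.mono hsub)
  obtain ⟨K, hK⟩ := isCompact_uIcc.exists_bound_of_continuousOn (hw.continuousOn (s := uIcc a b))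
  have hlt : ∀ x ∈ Ioo (-ρ) ρ, |x| < Y := fun x hx => (abs_lt.2 hx).trans hρY
  have hmem : ∀ x ∈ Ioo (-ρ) ρ, ∀ θ ∈ uIcc a b, x * σ θ ∈ Icc (-ρ) ρ := by
    intro x hx θ hθ
    rw [mem_Icc, ← abs_le, abs_mul]
    exact (mul_le_of_le_one_right (abs_nonneg _) (hσ1 θ hθ)).trans (abs_lt.2 hx).le
  have hs : Ioo (-ρ) ρ ∈ 𝓝 r := Ioo_mem_nhds (abs_lt.1 hrρ).1 (abs_lt.1 hrρ).2
  refine (intervalIntegral.hasDerivAt_integral_of_dominated_loc_of_deriv_le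
    (F := fun r θ => w θ * φ (r * σ θ)) (F' := fun r θ => w θ * σ θ * φ' (r * σ θ))
    (bound := fun _ => K * C) hs ?_ ?_ ?_ ?_ ?_ ?_).2
  · filter_upwards [hs] with x hx
    exact ((continuousOn_mul_comp_mul hφc hw hσ hσ1 (hlt x hx)).intervalIntegrable).def'.1
  · exact (continuousOn_mul_comp_mul hφc hw hσ hσ1 hr).intervalIntegrable
  · exact ((continuousOn_mul_comp_mul hφ' (hw.mul hσ) hσ hσ1 hr).intervalIntegrable).def'.1
  · refine ae_of_all _ fun θ hθ x hx => ?_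
    have hθ' := uIoc_subset_uIcc hθ
    have h1 := hC _ (hmem x hx θ hθ')
    have h2 := hK θ hθ'
    rw [norm_mul, norm_mul]
    refine mul_le_mul ?_ h1 (norm_nonneg _) ((norm_nonneg _).trans h2)
    exact (mul_le_of_le_one_right (norm_nonneg _) (hσ1 θ hθ')).trans h2
  · exact intervalIntegrable_const
  · refine ae_of_all _ fun θ hθ x hx => ?_
    have h1 := (hφ _ (hsub (hmem x hx θ (uIoc_subset_uIcc hθ))))
    have h2 := (h1.comp x ((hasDerivAt_id x).mul_const (σ θ))).const_mul (w θ)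
    exact HasDerivAt.congr_deriv h2 (by ring)

theorem contDiff_integral_mul_comp_mul {φ : ℝ → ℝ} (hφ : ContDiff ℝ ∞ φ) {w : ℝ → ℝ}
    (hw : Continuous w) : ContDiff ℝ ∞ fun x => ∫ θ in (0 : ℝ)..1, w θ * φ (x * θ) := by
  have hd : ∀ φ : ℝ → ℝ, ContDiff ℝ ∞ φ → ∀ w : ℝ → ℝ, Continuous w → ∀ x,
      HasDerivAt (fun x => ∫ θ in (0 : ℝ)..1, w θ * φ (x * θ))
        (∫ θ in (0 : ℝ)..1, w θ * θ * deriv φ (x * θ)) x := by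
    intro φ hφ w hw x
    refine hasDerivAt_integral_mul_comp_mul (σ := fun θ => θ) (Y := |x| + 1)
      (fun y _ => (hφ.differentiable (by simp) y).hasDerivAt)
      (hφ.continuous_deriv (by simp)).continuousOn hw continuous_id (fun θ hθ => ?_) (by linarith)
    rw [uIcc_of_le zero_le_one] at hθ
    rw [abs_of_nonneg hθ.1]; exact hθ.2
  refine contDiff_infty.2 fun n => ?_
  induction n generalizing φ w with
  | zero =>
    exact contDiff_zero.2 (continuous_iff_continuousAt.2 fun x => (hd φ hφ w hw x).continuousAt)
  | succ n ih =>
    push_cast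
    refine contDiff_succ_iff_deriv.2 ⟨fun x => (hd φ hφ w hw x).differentiableAt, by simp, ?_⟩
    have : (deriv fun x => ∫ θ in (0 : ℝ)..1, w θ * φ (x * θ)) =
        fun x => ∫ θ in (0 : ℝ)..1, w θ * θ * deriv φ (x * θ) :=
      funext fun x => (hd φ hφ w hw x).deriv
    rw [this]
    exact ih (contDiff_infty_iff_deriv.1 hφ).2 (hw.mul continuous_id)

/-- Hadamard's lemma in one variable. -/
theorem exists_contDiff_eq_add_mul {f : ℝ → ℝ} (hf : ContDiff ℝ ∞ f) :
    ∃ g : ℝ → ℝ, ContDiff ℝ ∞ g ∧ g 0 = deriv f 0 ∧ ∀ x, f x = f 0 + x * g x := by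
  have hf' : ContDiff ℝ ∞ (deriv f) := (contDiff_infty_iff_deriv.1 hf).2
  refine ⟨fun x => ∫ θ in (0 : ℝ)..1, 1 * deriv f (x * θ),
    contDiff_integral_mul_comp_mul hf' continuous_const, by simp, fun x => ?_⟩
  have h : ∀ θ ∈ uIcc (0 : ℝ) 1, HasDerivAt (fun θ => f (x * θ)) (deriv f (x * θ) * x) θ := by
    intro θ _
    have := (hf.differentiable (by simp) (x * θ)).hasDerivAt.comp θ ((hasDerivAt_id θ).const_mul x)
    exact HasDerivAt.congr_deriv this (by simp)
  have hint := intervalIntegral.integral_eq_sub_of_hasDerivAt h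
    (((hf'.continuous.comp (continuous_const.mul continuous_id)).mul
      continuous_const).intervalIntegrable 0 1)
  simp only [mul_one, mul_zero] at hint
  simp only [one_mul]
  rw [intervalIntegral.integral_mul_const] at hint
  linarith

/-! ### Functions in `Ω_rev` and the Morse coordinate at the maximum -/

theorem SmoothPeriodic.contDiff_deriv (U : SmoothPeriodic) : ContDiff ℝ ∞ (deriv U.toFun) :=
  (contDiff_infty_iff_deriv.1 U.contDiff).2

theorem SmoothPeriodic.apply_fract (U : SmoothPeriodic) (q : ℝ) :
    U.toFun (Int.fract q) = U.toFun q := by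
  have := U.periodic.sub_int_mul_eq ⌊q⌋ (x := q)
  rw [mul_one] at this
  exact this

theorem SmoothPeriodic.apply_fract_add (U : SmoothPeriodic) (q x : ℝ) :
    U.toFun (x + ⌊q⌋) = U.toFun x := by
  simpa using U.periodic.int_mul ⌊q⌋ x

theorem SmoothPeriodic.isLocalMin_fract (U : SmoothPeriodic) {q : ℝ} (h : IsLocalMin U.toFun q) :
    IsLocalMin U.toFun (Int.fract q) := by
  have hc : Tendsto (fun x : ℝ => x + ⌊q⌋) (𝓝 (Int.fract q)) (𝓝 q) := by
    have : ContinuousAt (fun x : ℝ => x + ⌊q⌋) (Int.fract q) := by fun_prop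
    simpa [ContinuousAt] using this
  filter_upwards [hc.eventually h] with x hx
  rw [U.apply_fract_add] at hx
  rwa [U.apply_fract]

theorem SmoothPeriodic.isLocalMax_fract (U : SmoothPeriodic) {q : ℝ} (h : IsLocalMax U.toFun q) :
    IsLocalMax U.toFun (Int.fract q) := by
  have hc : Tendsto (fun x : ℝ => x + ⌊q⌋) (𝓝 (Int.fract q)) (𝓝 q) := by
    have : ContinuousAt (fun x : ℝ => x + ⌊q⌋) (Int.fract q) := by fun_prop
    simpa [ContinuousAt] using this
  filter_upwards [hc.eventually h] with x hx
  rw [U.apply_fract_add] at hx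
  rwa [U.apply_fract]

/-- A function with nonvanishing derivative and `f a < f b` has positive derivative. -/
theorem deriv_pos_of_ne_zero {f : ℝ → ℝ} (hf : ContDiff ℝ ∞ f) {a b : ℝ} (hab : a < b)
    (hlt : f a < f b) (hne : ∀ x ∈ Ioo a b, deriv f x ≠ 0) : ∀ x ∈ Ioo a b, 0 < deriv f x := by
  obtain ⟨ξ, hξ, hslope⟩ := exists_deriv_eq_slope f hab hf.continuous.continuousOn
    (hf.differentiable (by simp)).differentiableOn
  have hpos : 0 < deriv f ξ := by
    rw [hslope]
    exact div_pos (by linarith) (by linarith)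
  intro x hx
  by_contra hcon
  have hsub : uIcc x ξ ⊆ Ioo a b := ordConnected_Ioo.uIcc_subset hx hξ
  obtain ⟨z, hz, hz0⟩ := intermediate_value_uIcc
    ((hf.continuous_deriv (by simp)).continuousOn (s := uIcc x ξ))
    (show (0 : ℝ) ∈ _ from mem_uIcc_of_le (not_lt.1 hcon) hpos.le)
  exact hne z (hsub hz) hz0

/-- On one period starting at a minimum point `M + p`, a function in `Ω_rev` increases up to a
maximum point `M` and decreases afterwards. -/
theorem exists_max_min {U : SmoothPeriodic} (hU : U ∈ OmegaRev) :
    ∃ M p : ℝ, -1 < p ∧ p < 0 ∧ c₂ U.toFun < c₁ U.toFun ∧ U.toFun M = c₁ U.toFun ∧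
      U.toFun (M + p) = c₂ U.toFun ∧ deriv (deriv U.toFun) M < 0 ∧
      0 < deriv (deriv U.toFun) (M + p) ∧
      (∀ x ∈ Ioo p 0, 0 < deriv U.toFun (M + x)) ∧
      ∀ x ∈ Ioo 0 (p + 1), deriv U.toFun (M + x) < 0 := by
  obtain ⟨-, ⟨m, ⟨hm, -⟩, hmuniq⟩, ⟨M, ⟨hM, -⟩, hMuniq⟩, hcrit⟩ := hU
  have hmin : ∀ q, IsLocalMin U.toFun q → Int.fract q = m := fun q hq =>
    hmuniq _ ⟨⟨Int.fract_nonneg q, Int.fract_lt_one q⟩, U.isLocalMin_fract hq⟩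
  have hmax : ∀ q, IsLocalMax U.toFun q → Int.fract q = M := fun q hq =>
    hMuniq _ ⟨⟨Int.fract_nonneg q, Int.fract_lt_one q⟩, U.isLocalMax_fract hq⟩
  obtain ⟨m', hm', hle⟩ := U.exists_min
  obtain ⟨M', hM', hge⟩ := U.exists_max
  have hUm : U.toFun m = c₂ U.toFun := by
    rw [← hmin m' (Eventually.of_forall fun q => hm'.symm ▸ hle q), U.apply_fract, hm']
  have hUM : U.toFun M = c₁ U.toFun := by
    rw [← hmax M' (Eventually.of_forall fun q => hM'.symm ▸ hge q), U.apply_fract, hM']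
  have hcc : c₂ U.toFun < c₁ U.toFun := by
    refine lt_of_le_of_ne (hUm ▸ hge m) fun heq => ?_
    have hconst : U.toFun = fun _ => c₁ U.toFun :=
      funext fun q => le_antisymm (hge q) (heq ▸ hle q)
    have hd : deriv U.toFun = fun _ => 0 := by rw [hconst]; exact funext fun q => deriv_const _ _
    exact hcrit 0 (by rw [hd]) (by rw [hd]; exact deriv_const _ _)
  have hmM : m ≠ M := by
    rintro rfl
    exact hcc.ne (hUm.symm.trans hUM)
  have hfM : Int.fract M = M := Int.fract_eq_self.2 hM
  have hfm : Int.fract m = m := Int.fract_eq_self.2 hm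
  have hpp : ∀ q, deriv U.toFun q = 0 → 0 < deriv (deriv U.toFun) q → Int.fract q = m :=
    fun q h1 h2 => hmin q (isLocalMin_of_deriv_deriv_pos h2 h1 U.continuous.continuousAt)
  have hnn : ∀ q, deriv U.toFun q = 0 → deriv (deriv U.toFun) q < 0 → Int.fract q = M :=
    fun q h1 h2 => hmax q (isLocalMax_of_deriv_deriv_neg h2 h1 U.continuous.continuousAt)
  have hdM : deriv U.toFun M = 0 :=
    IsLocalMax.deriv_eq_zero (Eventually.of_forall fun q => hUM.symm ▸ hge q)
  obtain ⟨p, n, hp1, hp0, hpn⟩ : ∃ (p : ℝ) (n : ℤ), -1 < p ∧ p < 0 ∧ M + p = m + n := by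
    rcases hmM.lt_or_gt with h | h
    · exact ⟨m - M, 0, by linarith [hm.1, hM.2], by linarith, by push_cast; ring⟩
    · exact ⟨m - 1 - M, -1, by linarith [hm.1, hM.2], by linarith [hm.2, hM.1], by push_cast; ring⟩
  have hUp : U.toFun (M + p) = c₂ U.toFun := by
    rw [hpn, ← U.apply_fract, Int.fract_add_intCast, hfm, hUm]
  have hdp : deriv U.toFun (M + p) = 0 :=
    IsLocalMin.deriv_eq_zero (Eventually.of_forall fun q => hUp.symm ▸ hle q)
  have hUp1 : U.toFun (M + (p + 1)) = c₂ U.toFun := by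
    rw [← add_assoc, U.periodic, hUp]
  have hfp : Int.fract (M + p) = m := by rw [hpn, Int.fract_add_intCast, hfm]
  have hne : ∀ x ∈ Ioo p (p + 1), x ≠ 0 → deriv U.toFun (M + x) ≠ 0 := by
    intro x hx hx0 hd
    rcases (hcrit _ hd).lt_or_gt with h | h
    · have h1 := hnn _ hd h
      rw [← hfM, Int.fract_eq_fract] at h1
      obtain ⟨z, hz⟩ := h1
      have hxz : x = z := by linarith
      have hz1 : (-1 : ℝ) < z := by linarith [hx.1]
      have hz2 : (z : ℝ) < 1 := by linarith [hx.2]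
      have hz1' : (-1 : ℤ) < z := by exact_mod_cast hz1
      have hz2' : z < (1 : ℤ) := by exact_mod_cast hz2
      have : z = 0 := by omega
      exact hx0 (by rw [hxz, this]; simp)
    · have h1 := hpp _ hd h
      rw [← hfp, Int.fract_eq_fract] at h1
      obtain ⟨z, hz⟩ := h1
      have hz1 : (0 : ℝ) < z := by linarith [hx.1]
      have hz2 : (z : ℝ) < 1 := by linarith [hx.2]
      have hz1' : (0 : ℤ) < z := by exact_mod_cast hz1
      have hz2' : z < (1 : ℤ) := by exact_mod_cast hz2
      omega
  refine ⟨M, p, hp1, hp0, hcc, hUM, hUp, ?_, ?_, ?_, ?_⟩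
  · refine (hcrit M hdM).lt_or_gt.resolve_right fun h => hmM ?_
    rw [← hpp M hdM h, hfM]
  · refine (hcrit _ hdp).lt_or_gt.resolve_left fun h => hmM ?_
    rw [← hnn _ hdp h, hfp]
  · intro x hx
    refine deriv_pos_of_ne_zero U.contDiff (a := M + p) (b := M) (by linarith) (by
      rw [hUp, hUM]; exact hcc) (fun y hy => ?_) (M + x) ⟨by linarith [hx.1], by linarith [hx.2]⟩
    have := hne (y - M) ⟨by linarith [hy.1], by linarith [hy.2]⟩ (by linarith [hy.2])
    rwa [add_sub_cancel] at this
  · intro x hx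
    have h := deriv_pos_of_ne_zero (f := fun q => -U.toFun q) U.contDiff.neg (a := M)
      (b := M + (p + 1)) (by linarith) (by rw [hUp1, hUM]; linarith) (fun y hy => ?_) (M + x)
      ⟨by linarith [hx.1], by linarith [hx.2]⟩
    · rw [deriv.fun_neg] at h
      linarith
    · have := hne (y - M) ⟨by linarith [hy.1], by linarith [hy.2]⟩ (by linarith [hy.1])
      rw [add_sub_cancel] at this
      rw [deriv.fun_neg]
      exact neg_ne_zero.2 this

/-- `ψ` inverts, on a period `(m, m + 1)` between two minimum points, the Morse coordinate of `U`
at its maximum: `U (ψ y) = c₁ - y ^ 2` for `|y| < Y`. -/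
structure IsMorseInverse (U : SmoothPeriodic) (m Y : ℝ) (ψ : ℝ → ℝ) : Prop where
  pos : 0 < Y
  sq : Y ^ 2 = c₁ U.toFun - c₂ U.toFun
  apply_min : U.toFun m = c₂ U.toFun
  deriv_deriv_min : 0 < deriv (deriv U.toFun) m
  contDiffOn : ContDiffOn ℝ ∞ ψ (Ioo (-Y) Y)
  deriv_pos : ∀ y ∈ Ioo (-Y) Y, 0 < deriv ψ y
  apply : ∀ y ∈ Ioo (-Y) Y, U.toFun (ψ y) = c₁ U.toFun - y ^ 2
  mapsTo : MapsTo ψ (Ioo (-Y) Y) (Ioo m (m + 1))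
  surjOn : SurjOn ψ (Ioo (-Y) Y) (Ioo m (m + 1))

/-- The inverse of a smooth function with positive derivative on an open interval. -/
theorem exists_inverse_of_deriv_pos {g : ℝ → ℝ} {a b A B : ℝ} (hab : a < b)
    (hg : ∀ x ∈ Icc a b, ContDiffAt ℝ ∞ g x) (hpos : ∀ x ∈ Ioo a b, 0 < deriv g x)
    (ha : g a = A) (hb : g b = B) :
    ∃ ψ : ℝ → ℝ, ContDiffOn ℝ ∞ ψ (Ioo A B) ∧ (∀ y ∈ Ioo A B, 0 < deriv ψ y) ∧
      (∀ y ∈ Ioo A B, ψ y ∈ Ioo a b ∧ g (ψ y) = y) ∧ SurjOn ψ (Ioo A B) (Ioo a b) := by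
  subst ha hb
  have hcont : ContinuousOn g (Icc a b) := fun x hx => (hg x hx).continuousAt.continuousWithinAt
  have hmono : StrictMonoOn g (Icc a b) :=
    strictMonoOn_of_deriv_pos (convex_Icc a b) hcont (by simpa using hpos)
  have hinj : InjOn g (Ioo a b) := hmono.injOn.mono Ioo_subset_Icc_self
  have hsurj : SurjOn g (Ioo a b) (Ioo (g a) (g b)) := intermediate_value_Ioo hab.le hcont
  have hψ : ∀ y ∈ Ioo (g a) (g b), Function.invFunOn g (Ioo a b) y ∈ Ioo a b ∧
      g (Function.invFunOn g (Ioo a b) y) = y := fun y hy =>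
    ⟨Function.invFunOn_mem (hsurj hy), Function.invFunOn_eq (hsurj hy)⟩
  have hkey : ∀ y ∈ Ioo (g a) (g b), ContDiffAt ℝ ∞ (Function.invFunOn g (Ioo a b)) y ∧
      0 < deriv (Function.invFunOn g (Ioo a b)) y := by
    intro y hy
    obtain ⟨hx, hgx⟩ := hψ y hy
    set x := Function.invFunOn g (Ioo a b) y with hxdef
    have hgc : ContDiffAt ℝ ∞ g x := hg x (Ioo_subset_Icc_self hx)
    have hd : HasDerivAt g (deriv g x) x := (hgc.differentiableAt (by simp)).hasDerivAt
    have hs : HasStrictDerivAt g (deriv g x) x := hgc.hasStrictDerivAt' hd (by simp)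
    have hne := (hpos x hx).ne'
    have hfd := hs.hasStrictFDerivAt_equiv hne
    have hL : ContDiffAt ℝ ∞ (hfd.localInverse g _ x) (g x) :=
      hgc.to_localInverse hfd.hasFDerivAt (by simp)
    -- the local inverse is the global one, by injectivity
    have heq : Function.invFunOn g (Ioo a b) =ᶠ[𝓝 y] hfd.localInverse g _ x := by
      have h1 : ∀ᶠ z in 𝓝 (g x), hfd.localInverse g _ x z ∈ Ioo a b :=
        hfd.localInverse_continuousAt.eventually
          (by rw [hfd.localInverse_apply_image]; exact isOpen_Ioo.mem_nhds hx)
      rw [hgx] at h1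
      have h2 := hfd.eventually_right_inverse
      rw [hgx] at h2
      filter_upwards [h1, h2, isOpen_Ioo.mem_nhds hy] with z hz1 hz2 hz3
      exact hinj (hψ z hz3).1 hz1 ((hψ z hz3).2.trans hz2.symm)
    rw [hgx] at hL
    have hC : ContDiffAt ℝ ∞ (Function.invFunOn g (Ioo a b)) y := hL.congr_of_eventuallyEq heq
    refine ⟨hC, ?_⟩
    have hcomp : HasDerivAt (fun z => g (Function.invFunOn g (Ioo a b) z))
        (deriv g x * deriv (Function.invFunOn g (Ioo a b)) y) y :=
      HasDerivAt.comp y hd (hC.differentiableAt (by simp)).hasDerivAt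
    have hid : (fun z => g (Function.invFunOn g (Ioo a b) z)) =ᶠ[𝓝 y] id := by
      filter_upwards [isOpen_Ioo.mem_nhds hy] with z hz using (hψ z hz).2
    have h1 := (hcomp.congr_of_eventuallyEq hid.symm).unique (hasDerivAt_id y)
    have h2 := hpos x hx
    exact pos_of_mul_pos_right (h1 ▸ one_pos) h2.le
  refine ⟨Function.invFunOn g (Ioo a b), fun y hy => (hkey y hy).1.contDiffWithinAt,
    fun y hy => (hkey y hy).2, hψ, fun x hx => ?_⟩
  have hgx : g x ∈ Ioo (g a) (g b) :=
    ⟨hmono ⟨le_rfl, hab.le⟩ (Ioo_subset_Icc_self hx) hx.1,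
      hmono (Ioo_subset_Icc_self hx) ⟨hab.le, le_rfl⟩ hx.2⟩
  exact ⟨g x, hgx, hinj (hψ _ hgx).1 hx (hψ _ hgx).2⟩

/-- Division of a smooth function by the square of the coordinate at a critical point. -/
theorem exists_contDiff_eq_sub_sq_mul {u : ℝ → ℝ} (hu : ContDiff ℝ ∞ u) (h0 : deriv u 0 = 0) :
    ∃ a : ℝ → ℝ, ContDiff ℝ ∞ a ∧ 2 * a 0 = -deriv (deriv u) 0 ∧
      ∀ x, u x = u 0 - x ^ 2 * a x := by
  obtain ⟨b, hb, hb0, hub⟩ := exists_contDiff_eq_add_mul hu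
  obtain ⟨e, he, he0, hbe⟩ := exists_contDiff_eq_add_mul hb
  refine ⟨fun x => -e x, he.neg, ?_, fun x => ?_⟩
  · have hbd : Differentiable ℝ b := hb.differentiable (by simp)
    have hbd2 : Differentiable ℝ (deriv b) :=
      (contDiff_infty_iff_deriv.1 hb).2.differentiable (by simp)
    have h1 : deriv u = fun x => b x + x * deriv b x := by
      funext x
      have h2 : u = fun x => u 0 + x * b x := funext hub
      have h3 := (((hasDerivAt_id x).mul (hbd x).hasDerivAt).const_add (u 0))
      rw [h2]
      refine (HasDerivAt.congr_deriv h3 ?_).deriv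
      simp
    have h4 : HasDerivAt (deriv u) (2 * deriv b 0) 0 := by
      rw [h1]
      refine HasDerivAt.congr_deriv ((hbd 0).hasDerivAt.add
        ((hasDerivAt_id (0 : ℝ)).mul (hbd2 0).hasDerivAt)) ?_
      simp; ring
    simp only [h4.deriv, he0]; ring
  · rw [hub x, hbe x, hb0, h0]; ring

/-- The Morse coordinate is `x √(a x)`, where `U (M + x) = c₁ - x ^ 2 a x` with `a` smooth; away
from the maximum point `M` its derivative is positive because that of `U` has the right sign. -/
theorem exists_isMorseInverse {U : SmoothPeriodic} (hU : U ∈ OmegaRev) :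
    ∃ m Y ψ, IsMorseInverse U m Y ψ := by
  obtain ⟨M, p, hp1, hp0, hcc, hM, hp, hM2, hp2, hinc, hdec⟩ := exists_max_min hU
  obtain ⟨-, -, hge⟩ := U.exists_max
  have hUd : Differentiable ℝ U.toFun := U.contDiff.differentiable (by simp)
  let u : ℝ → ℝ := fun x => U.toFun (M + x)
  have hu : ContDiff ℝ ∞ u := U.contDiff.comp (contDiff_const.add contDiff_id)
  have hu1 : deriv u = fun x => deriv U.toFun (M + x) :=
    funext fun x => deriv_comp_const_add U.toFun M x
  have hu2 : deriv (deriv u) 0 = deriv (deriv U.toFun) M := by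
    rw [hu1]
    exact (deriv_comp_const_add (deriv U.toFun) M 0).trans (by rw [add_zero])
  have hu0 : u 0 = c₁ U.toFun := by simp [u, hM]
  have hd0 : deriv u 0 = 0 :=
    IsLocalMax.deriv_eq_zero (Eventually.of_forall fun q => hu0.symm ▸ hge _)
  have hup : u p = c₂ U.toFun := hp
  have hup1 : u (p + 1) = c₂ U.toFun := by
    simp only [u]; rw [← add_assoc, U.periodic, hp]
  obtain ⟨a, ha, ha0, hua⟩ := exists_contDiff_eq_sub_sq_mul hu hd0
  rw [hu2] at ha0
  rw [hu0] at hua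
  have hlt : ∀ x ∈ Icc p (p + 1), x ≠ 0 → u x < c₁ U.toFun := by
    intro x hx hx0
    rw [← hu0]
    rcases hx0.lt_or_gt with h | h
    · refine strictMonoOn_of_deriv_pos (convex_Icc p 0) hu.continuous.continuousOn (fun y hy => ?_)
        ⟨hx.1, h.le⟩ ⟨hp0.le, le_rfl⟩ h
      rw [interior_Icc] at hy
      rw [hu1]; exact hinc y hy
    · refine strictAntiOn_of_deriv_neg (convex_Icc 0 (p + 1)) hu.continuous.continuousOn
        (fun y hy => ?_) ⟨le_rfl, by linarith⟩ ⟨h.le, hx.2⟩ h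
      rw [interior_Icc] at hy
      rw [hu1]; exact hdec y hy
  have hapos : ∀ x ∈ Icc p (p + 1), 0 < a x := by
    intro x hx
    rcases eq_or_ne x 0 with rfl | hx0
    · linarith
    · have := hlt x hx hx0
      rw [hua x] at this
      exact pos_of_mul_pos_right (by linarith) (sq_nonneg x)
  let g : ℝ → ℝ := fun x => x * √(a x)
  have hgsq : ∀ x ∈ Icc p (p + 1), g x ^ 2 = c₁ U.toFun - u x := by
    intro x hx
    simp only [g]
    rw [mul_pow, Real.sq_sqrt (hapos x hx).le, hua x]; ring
  have hgC : ∀ x ∈ Icc p (p + 1), ContDiffAt ℝ ∞ g x := fun x hx =>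
    contDiffAt_id.mul (ha.contDiffAt.sqrt (hapos x hx).ne')
  have hgd : ∀ x ∈ Ioo p (p + 1), 0 < deriv g x := by
    intro x hx
    have hx' := Ioo_subset_Icc_self hx
    have hsq := Real.sqrt_pos.2 (hapos x hx')
    have hgD := ((hgC x hx').differentiableAt (by simp)).hasDerivAt
    rcases eq_or_ne x 0 with rfl | hx0
    · have h1 : HasDerivAt g (1 * √(a 0) + id 0 * deriv (fun x => √(a x)) 0) 0 :=
        (hasDerivAt_id (0 : ℝ)).mul
          ((ha.contDiffAt.sqrt (hapos 0 hx').ne').differentiableAt (by simp)).hasDerivAt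
      rw [h1.deriv]
      simpa using hsq
    · have h1 : HasDerivAt (fun x => g x ^ 2) (2 * g x * deriv g x) x :=
        HasDerivAt.congr_deriv (hgD.pow 2) (by simp)
      have h2 : HasDerivAt (fun x => c₁ U.toFun - u x) (-deriv u x) x :=
        ((hu.differentiable (by simp) x).hasDerivAt).const_sub _
      have h3 : (fun x => g x ^ 2) =ᶠ[𝓝 x] fun x => c₁ U.toFun - u x := by
        filter_upwards [Icc_mem_nhds hx.1 hx.2] with y hy using hgsq y hy
      have h4 : 2 * g x * deriv g x = -deriv u x := (h1.congr_of_eventuallyEq h3.symm).unique h2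
      rw [hu1] at h4
      rcases hx0.lt_or_gt with h | h
      · have h5 := hinc x ⟨hx.1, h⟩
        have h6 : g x < 0 := mul_neg_of_neg_of_pos h hsq
        by_contra hcon
        have := mul_nonneg_of_nonpos_of_nonpos (show 2 * g x ≤ 0 by linarith) (not_lt.1 hcon)
        linarith
      · have h5 := hdec x ⟨h, hx.2⟩
        have h6 : 0 < g x := mul_pos h hsq
        exact pos_of_mul_pos_right (by linarith) (show 0 ≤ 2 * g x by linarith)
  have hpmem : p ∈ Icc p (p + 1) := ⟨le_rfl, by linarith⟩
  have hp1mem : p + 1 ∈ Icc p (p + 1) := ⟨by linarith, le_rfl⟩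
  have hgp : g p = -√(c₁ U.toFun - c₂ U.toFun) := by
    have h1 : g p < 0 := mul_neg_of_neg_of_pos hp0 (Real.sqrt_pos.2 (hapos p hpmem))
    rw [← hup, ← hgsq p hpmem, Real.sqrt_sq_eq_abs, abs_of_neg h1, neg_neg]
  have hgp1 : g (p + 1) = √(c₁ U.toFun - c₂ U.toFun) := by
    have h1 : 0 < g (p + 1) := mul_pos (by linarith) (Real.sqrt_pos.2 (hapos _ hp1mem))
    rw [← hup1, ← hgsq _ hp1mem, Real.sqrt_sq_eq_abs, abs_of_pos h1]
  obtain ⟨φ, hφC, hφd, hφ, hφs⟩ := exists_inverse_of_deriv_pos (by linarith) hgC hgd hgp hgp1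
  refine ⟨M + p, √(c₁ U.toFun - c₂ U.toFun), fun y => M + φ y, ?_⟩
  refine ⟨Real.sqrt_pos.2 (by linarith), Real.sq_sqrt (by linarith), hp, hp2,
    contDiffOn_const.add hφC, fun y hy => ?_, fun y hy => ?_, fun y hy => ?_, fun q hq => ?_⟩
  · rw [deriv_const_add]; exact hφd y hy
  · have h1 := hgsq _ (Ioo_subset_Icc_self (hφ y hy).1)
    rw [(hφ y hy).2] at h1
    show u (φ y) = _
    linarith
  · have := (hφ y hy).1
    exact ⟨by linarith [this.1], by linarith [this.2]⟩
  · obtain ⟨y, hy, hyq⟩ := hφs (show q - M ∈ Ioo p (p + 1) from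
      ⟨by linarith [hq.1], by linarith [hq.2]⟩)
    exact ⟨y, hy, by simp only [hyq]; ring⟩

/-! ### The curvature below the minimum value -/

/-- Differentiation of `∫ φ(U - c)` in `c` below the minimum of `U`, where the integrand stays in a
compact part of the domain of `φ`. -/
theorem hasDerivAt_integral_comp_sub {U : SmoothPeriodic} {φ φ' : ℝ → ℝ}
    (hφ : ∀ y, 0 < y → HasDerivAt φ (φ' y) y) (hφ' : ContinuousOn φ' (Ioi 0)) {c : ℝ}
    (hc : c ∈ Ioo 0 (c₂ U.toFun)) :
    HasDerivAt (fun c => ∫ q in (0 : ℝ)..1, φ (U.toFun q - c))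
      (-∫ q in (0 : ℝ)..1, φ' (U.toFun q - c)) c := by
  obtain ⟨d, hcd, hd⟩ := exists_between hc.2
  obtain ⟨-, -, hle⟩ := U.exists_min
  obtain ⟨-, -, hge⟩ := U.exists_max
  have hφc : ContinuousOn φ (Ioi 0) := fun y hy => (hφ y hy).continuousAt.continuousWithinAt
  have hsub : Icc (c₂ U.toFun - d) (c₁ U.toFun) ⊆ Ioi 0 := fun y hy => by
    have := hy.1
    simp only [mem_Ioi]; linarith
  obtain ⟨C, hC⟩ := isCompact_Icc.exists_bound_of_continuousOn (hφ'.mono hsub)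
  have hmem : ∀ x ∈ Ioo 0 d, ∀ q, U.toFun q - x ∈ Icc (c₂ U.toFun - d) (c₁ U.toFun) :=
    fun x hx q => ⟨by linarith [hle q, hx.2], by linarith [hge q, hx.1]⟩
  have hcont : ∀ {χ : ℝ → ℝ}, ContinuousOn χ (Ioi 0) → ∀ x ∈ Ioo 0 d,
      Continuous fun q => χ (U.toFun q - x) := fun hχ x hx =>
    hχ.comp_continuous (U.continuous.sub continuous_const) fun q => hsub (hmem x hx q)
  have hs : Ioo 0 d ∈ 𝓝 c := Ioo_mem_nhds hc.1 hcd
  have h := (intervalIntegral.hasDerivAt_integral_of_dominated_loc_of_deriv_le (a := 0) (b := 1)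
    (μ := volume) (F := fun x q => φ (U.toFun q - x)) (F' := fun x q => -φ' (U.toFun q - x))
    (bound := fun _ => C) hs ?_ ?_ ?_ ?_ ?_ ?_).2
  · rwa [intervalIntegral.integral_neg] at h
  · filter_upwards [hs] with x hx using (hcont hφc x hx).aestronglyMeasurable
  · exact (hcont hφc c ⟨hc.1, hcd⟩).intervalIntegrable _ _
  · exact (hcont hφ' c ⟨hc.1, hcd⟩).neg.aestronglyMeasurable
  · refine ae_of_all _ fun q _ x hx => ?_
    rw [norm_neg]
    exact hC _ (hmem x hx q)
  · exact intervalIntegrable_const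
  · refine ae_of_all _ fun q _ x hx => ?_
    have h2 := (hφ _ (hsub (hmem x hx q))).comp x ((hasDerivAt_id x).const_sub (U.toFun q))
    exact HasDerivAt.congr_deriv h2 (by ring)

theorem integral_comp_sub_pos {U : SmoothPeriodic} {φ : ℝ → ℝ} (hφ : ContinuousOn φ (Ioi 0))
    (hpos : ∀ y, 0 < y → 0 < φ y) {c : ℝ} (hc : c < c₂ U.toFun) :
    0 < ∫ q in (0 : ℝ)..1, φ (U.toFun q - c) := by
  obtain ⟨-, -, hle⟩ := U.exists_min
  have h : ∀ q, 0 < U.toFun q - c := fun q => by linarith [hle q]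
  exact intervalIntegral.intervalIntegral_pos_of_pos
    ((hφ.comp_continuous (U.continuous.sub continuous_const) h).intervalIntegrable _ _)
    (fun q => hpos _ (h q)) zero_lt_one

theorem SmoothPeriodic.c₂_le_c₁ (U : SmoothPeriodic) : c₂ U.toFun ≤ c₁ U.toFun := by
  obtain ⟨m, hm, -⟩ := U.exists_min
  obtain ⟨-, -, h⟩ := U.exists_max
  exact hm ▸ h m

/-- Below the minimum of `U` both `F₁` and `F₂` are concave, `F₁` is decreasing and `F₂` is
increasing, so that the curvature is positive. -/
theorem curvature_ne_zero_of_lt_min (U : SmoothPeriodic) {c : ℝ} (hc : c ∈ Ioo 0 (c₂ U.toFun)) :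
    curvature U.toFun c ≠ 0 := by
  have hs : ∀ y : ℝ, 0 < y → 0 < √y := fun y hy => Real.sqrt_pos.2 hy
  have hcs : ContinuousOn (fun y : ℝ => √y) (Ioi 0) := Real.continuous_sqrt.continuousOn
  have hφ1 : ∀ y : ℝ, 0 < y → HasDerivAt (fun y => √y) (1 / (2 * √y)) y := fun y hy =>
    Real.hasDerivAt_sqrt hy.ne'
  have hφ2 : ∀ y : ℝ, 0 < y → HasDerivAt (fun y => 1 / (2 * √y)) (-(1 / (4 * y * √y))) y := by
    intro y hy
    have hsy := hs y hy
    have h2 := ((Real.hasDerivAt_sqrt hy.ne').const_mul 2).inv (by positivity)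
    simp only [one_div]
    refine HasDerivAt.congr_deriv h2 ?_
    have h3 : √y ^ 2 = y := Real.sq_sqrt hy.le
    field_simp
    rw [h3]; ring
  have hc1 : ContinuousOn (fun y : ℝ => 1 / (2 * √y)) (Ioi 0) := fun y hy =>
    (hφ2 y hy).continuousAt.continuousWithinAt
  have hc2 : ContinuousOn (fun y : ℝ => 1 / (4 * y * √y)) (Ioi 0) :=
    continuousOn_const.div ((continuousOn_const.mul continuousOn_id).mul hcs) fun y hy => by
      have := hs y hy
      have : 0 < y := hy
      positivity
  have hc0 : c₂ U.toFun ≤ c₁ U.toFun := U.c₂_le_c₁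
  have hF : F₁ U.toFun = fun c => ∫ q in (0 : ℝ)..1, √(U.toFun q - c) :=
    funext fun c => F₁_eq_intervalIntegral _ _
  have hmem : ∀ x ∈ Ioo 0 (c₂ U.toFun), x ∈ Ioc 0 (c₁ U.toFun) := fun x hx =>
    ⟨hx.1, hx.2.le.trans hc0⟩
  have hD1 : ∀ x ∈ Ioo 0 (c₂ U.toFun), D U.toFun (F₁ U.toFun) x =
      -∫ q in (0 : ℝ)..1, 1 / (2 * √(U.toFun q - x)) := fun x hx => by
    refine D_eq (hmem x hx) (HasDerivAt.hasDerivWithinAt ?_)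
    rw [hF]
    exact hasDerivAt_integral_comp_sub hφ1 hc1 hx
  have hD2 : D U.toFun (D U.toFun (F₁ U.toFun)) c =
      -∫ q in (0 : ℝ)..1, 1 / (4 * (U.toFun q - c) * √(U.toFun q - c)) := by
    have heq : D U.toFun (F₁ U.toFun) =ᶠ[𝓝[Iic (c₁ U.toFun)] c]
        fun x => -∫ q in (0 : ℝ)..1, 1 / (2 * √(U.toFun q - x)) := by
      filter_upwards [mem_nhdsWithin_of_mem_nhds (Ioo_mem_nhds hc.1 hc.2)] with x hx using hD1 x hx
    rw [D_congr heq (hmem c hc).2]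
    refine D_eq (hmem c hc) (HasDerivAt.hasDerivWithinAt ?_)
    have := (hasDerivAt_integral_comp_sub hφ2 hc2.neg hc).neg
    refine HasDerivAt.congr_deriv this ?_
    simp only [intervalIntegral.integral_neg, neg_neg]
  have hP := integral_comp_sub_pos hc1 (fun y hy => by have := hs y hy; positivity) hc.2
  have hQ := integral_comp_sub_pos hc2 (fun y hy => by have := hs y hy; positivity) hc.2
  have hc' := hc.1
  have hsc := hs c hc.1
  rw [curvature, hD1 c hc, hD2, D_F₂ (hmem c hc), D_D_F₂ (hmem c hc)]
  refine (div_pos ?_ (Real.rpow_pos_of_pos (by positivity) _)).ne'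
  have h1 : 0 < 1 / (4 * c * √c) := by positivity
  have h2 : 0 < 1 / (2 * √c) := by positivity
  have h3 := mul_pos h1 hP
  have h4 := mul_pos hQ h2
  have h5 : -1 / (4 * c * √c) = -(1 / (4 * c * √c)) := by ring
  rw [h5]
  linarith

/-! ### Regularity of `F₁` up to the maximum value -/

/-- `∫ w(θ) φ(r sin θ) dθ` over `[-π/2, π/2]`. -/
noncomputable def angularIntegral (w φ : ℝ → ℝ) (r : ℝ) : ℝ :=
  ∫ θ in (-(Real.pi / 2))..(Real.pi / 2), w θ * φ (r * Real.sin θ)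

section angular

variable {φ w : ℝ → ℝ} {Y r : ℝ}

theorem contDiffOn_deriv_Ioo (h : ContDiffOn ℝ ∞ φ (Ioo (-Y) Y)) :
    ContDiffOn ℝ ∞ (deriv φ) (Ioo (-Y) Y) :=
  ((contDiffOn_infty_iff_deriv_of_isOpen isOpen_Ioo).1 h).2

theorem hasDerivAt_of_contDiffOn_Ioo (h : ContDiffOn ℝ ∞ φ (Ioo (-Y) Y)) :
    ∀ y ∈ Ioo (-Y) Y, HasDerivAt φ (deriv φ y) y := fun y hy =>
  ((h.differentiableOn (by simp)).differentiableAt (isOpen_Ioo.mem_nhds hy)).hasDerivAt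

theorem mul_sin_mem (hr : |r| < Y) (θ : ℝ) : r * Real.sin θ ∈ Ioo (-Y) Y := by
  rw [mem_Ioo, ← abs_lt, abs_mul]
  exact (mul_le_of_le_one_right (abs_nonneg _) (Real.abs_sin_le_one θ)).trans_lt hr

theorem continuous_comp_mul_sin (hφ : ContinuousOn φ (Ioo (-Y) Y)) (hr : |r| < Y) :
    Continuous fun θ => φ (r * Real.sin θ) :=
  hφ.comp_continuous (continuous_const.mul Real.continuous_sin) (mul_sin_mem hr)

theorem hasDerivAt_angularIntegral (hφ : ContDiffOn ℝ ∞ φ (Ioo (-Y) Y)) (hw : Continuous w)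
    (hr : |r| < Y) :
    HasDerivAt (angularIntegral w φ)
      (angularIntegral (fun θ => w θ * Real.sin θ) (deriv φ) r) r :=
  hasDerivAt_integral_mul_comp_mul (hasDerivAt_of_contDiffOn_Ioo hφ)
    (contDiffOn_deriv_Ioo hφ).continuousOn hw Real.continuous_sin
    (fun θ _ => Real.abs_sin_le_one θ) hr

/-- The weight `cos²` turns into the weight `1` on differentiating, thanks to an integration by
parts. -/
theorem hasDerivAt_sq_mul_angularIntegral (hφ : ContDiffOn ℝ ∞ φ (Ioo (-Y) Y)) (hr : |r| < Y) :
    HasDerivAt (fun r => r ^ 2 * angularIntegral (fun θ => Real.cos θ ^ 2) φ r)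
      (r * angularIntegral (fun _ => 1) φ r) r := by
  have hcφ := continuous_comp_mul_sin hφ.continuousOn hr
  have hcφ' := continuous_comp_mul_sin (contDiffOn_deriv_Ioo hφ).continuousOn hr
  have hcs : Continuous fun θ => Real.cos θ := Real.continuous_cos
  have hsn : Continuous fun θ => Real.sin θ := Real.continuous_sin
  refine HasDerivAt.congr_deriv ((hasDerivAt_pow 2 r).mul
    (hasDerivAt_angularIntegral hφ (hcs.pow 2) hr)) ?_
  have hparts := intervalIntegral.integral_mul_deriv_eq_deriv_mul
    (a := -(Real.pi / 2)) (b := Real.pi / 2)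
    (u := fun θ => Real.cos θ * Real.sin θ)
    (u' := fun θ => -Real.sin θ * Real.sin θ + Real.cos θ * Real.cos θ)
    (v := fun θ => φ (r * Real.sin θ)) (v' := fun θ => deriv φ (r * Real.sin θ) * (r * Real.cos θ))
    (fun θ _ => (Real.hasDerivAt_cos θ).mul (Real.hasDerivAt_sin θ))
    (fun θ _ => (hasDerivAt_of_contDiffOn_Ioo hφ _ (mul_sin_mem hr θ)).comp θ
      ((Real.hasDerivAt_sin θ).const_mul r))
    (((hsn.neg.mul hsn).add (hcs.mul hcs)).intervalIntegrable _ _)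
    ((hcφ'.mul (continuous_const.mul hcs)).intervalIntegrable _ _)
  simp only [Real.cos_pi_div_two, Real.cos_neg, zero_mul, sub_zero, zero_sub] at hparts
  have h1 : r * angularIntegral (fun θ => Real.cos θ ^ 2 * Real.sin θ) (deriv φ) r =
      -∫ θ in (-(Real.pi / 2))..(Real.pi / 2),
        (-Real.sin θ * Real.sin θ + Real.cos θ * Real.cos θ) * φ (r * Real.sin θ) := by
    rw [← hparts, angularIntegral, ← intervalIntegral.integral_const_mul]
    exact intervalIntegral.integral_congr fun θ _ => by ring
  have h2 : angularIntegral (fun _ => 1) φ r =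
      2 * angularIntegral (fun θ => Real.cos θ ^ 2) φ r -
      ∫ θ in (-(Real.pi / 2))..(Real.pi / 2),
        (-Real.sin θ * Real.sin θ + Real.cos θ * Real.cos θ) * φ (r * Real.sin θ) := by
    simp only [angularIntegral]
    have hi1 : Continuous fun θ => 2 * (Real.cos θ ^ 2 * φ (r * Real.sin θ)) :=
      continuous_const.mul ((hcs.pow 2).mul hcφ)
    have hi2 : Continuous fun θ =>
        (-Real.sin θ * Real.sin θ + Real.cos θ * Real.cos θ) * φ (r * Real.sin θ) :=
      ((hsn.neg.mul hsn).add (hcs.mul hcs)).mul hcφ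
    rw [← intervalIntegral.integral_const_mul, ← intervalIntegral.integral_sub
      (hi1.intervalIntegrable _ _) (hi2.intervalIntegrable _ _)]
    refine intervalIntegral.integral_congr fun θ _ => ?_
    linear_combination -φ (r * Real.sin θ) * Real.sin_sq_add_cos_sq θ
  rw [h2]
  have h3 : r ^ 2 * angularIntegral (fun θ => Real.cos θ ^ 2 * Real.sin θ) (deriv φ) r =
      r * (r * angularIntegral (fun θ => Real.cos θ ^ 2 * Real.sin θ) (deriv φ) r) := by ring
  rw [h3, h1]
  push_cast
  ring

theorem angularIntegral_sin_zero : angularIntegral (fun θ => 1 * Real.sin θ) φ 0 = 0 := by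
  simp [angularIntegral]

end angular

section morse

variable {U : SmoothPeriodic} {m Y : ℝ} {ψ : ℝ → ℝ} {c : ℝ}

theorem IsMorseInverse.strictMonoOn (h : IsMorseInverse U m Y ψ) :
    StrictMonoOn ψ (Ioo (-Y) Y) :=
  strictMonoOn_of_deriv_pos (convex_Ioo _ _) h.contDiffOn.continuousOn
    (by rw [interior_Ioo]; exact h.deriv_pos)

theorem IsMorseInverse.sqrt_lt (h : IsMorseInverse U m Y ψ) (hc : c₂ U.toFun < c) :
    |√(c₁ U.toFun - c)| < Y := by
  rw [abs_of_nonneg (Real.sqrt_nonneg _), Real.sqrt_lt' h.pos, h.sq]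
  linarith

/-- The substitution `q = ψ (r sin θ)`, `r = √(c₁ - c)`, in the integral defining `F₁`. -/
theorem IsMorseInverse.F₁_eq (h : IsMorseInverse U m Y ψ)
    (hc : c ∈ Ioc (c₂ U.toFun) (c₁ U.toFun)) :
    F₁ U.toFun c = √(c₁ U.toFun - c) ^ 2 *
      angularIntegral (fun θ => Real.cos θ ^ 2) (deriv ψ) √(c₁ U.toFun - c) := by
  set r := √(c₁ U.toFun - c) with hrdef
  have hr : |r| < Y := h.sqrt_lt hc.1
  have hr0 : 0 ≤ r := Real.sqrt_nonneg _
  have hrsq : r ^ 2 = c₁ U.toFun - c := Real.sq_sqrt (by linarith [hc.2])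
  have hrm : r ∈ Ioo (-Y) Y := abs_lt.1 hr
  have hrm' : -r ∈ Ioo (-Y) Y := ⟨by linarith [hrm.2], by linarith [hrm.1]⟩
  have hcont : Continuous fun q => √(U.toFun q - c) :=
    (U.continuous.sub continuous_const).sqrt
  have hper : Function.Periodic (fun q => √(U.toFun q - c)) 1 := fun q => by
    simp only [U.periodic q]
  have hzero : ∀ q ∈ Icc m (m + 1), (q ≤ ψ (-r) ∨ ψ r ≤ q) → √(U.toFun q - c) = 0 := by
    intro q hq hqr
    refine Real.sqrt_eq_zero_of_nonpos ?_
    rcases hq.1.eq_or_lt with rfl | h1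
    · rw [h.apply_min]; linarith [hc.1]
    rcases hq.2.eq_or_lt with rfl | h2
    · rw [U.periodic, h.apply_min]; linarith [hc.1]
    obtain ⟨y, hy, rfl⟩ := h.surjOn ⟨h1, h2⟩
    rw [h.apply y hy]
    have : r ^ 2 ≤ y ^ 2 := by
      rcases hqr with hqr | hqr
      · have := (h.strictMonoOn.le_iff_le hy hrm').1 hqr
        nlinarith
      · have := (h.strictMonoOn.le_iff_le hrm hy).1 hqr
        nlinarith
    linarith
  have hm1 := h.mapsTo hrm'
  have hm2 := h.mapsTo hrm
  have hm12 : ψ (-r) ≤ ψ r := h.strictMonoOn.monotoneOn hrm' hrm (by linarith)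
  have hF : F₁ U.toFun c = ∫ q in ψ (-r)..ψ r, √(U.toFun q - c) := by
    rw [F₁_eq_intervalIntegral]
    have h1 := hper.intervalIntegral_add_eq 0 m
    rw [zero_add] at h1
    have hi : ∀ a b, IntervalIntegrable (fun q => √(U.toFun q - c)) volume a b :=
      fun a b => hcont.intervalIntegrable a b
    have hz1 : ∫ q in m..ψ (-r), √(U.toFun q - c) = 0 := by
      refine (intervalIntegral.integral_congr (g := fun _ => (0 : ℝ))
        fun q hq => ?_).trans (by simp)
      rw [uIcc_of_le hm1.1.le] at hq
      exact hzero q ⟨hq.1, hq.2.trans hm1.2.le⟩ (Or.inl hq.2)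
    have hz2 : ∫ q in ψ r..(m + 1), √(U.toFun q - c) = 0 := by
      refine (intervalIntegral.integral_congr (g := fun _ => (0 : ℝ))
        fun q hq => ?_).trans (by simp)
      rw [uIcc_of_le hm2.2.le] at hq
      exact hzero q ⟨hm2.1.le.trans hq.1, hq.2⟩ (Or.inr hq.1)
    rw [h1, ← intervalIntegral.integral_add_adjacent_intervals (hi m (ψ (-r))) (hi _ _),
      ← intervalIntegral.integral_add_adjacent_intervals (hi (ψ (-r)) (ψ r)) (hi _ _), hz1, hz2]
    ring
  have hsubst := intervalIntegral.integral_comp_mul_deriv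
    (a := -(Real.pi / 2)) (b := Real.pi / 2) (f := fun θ => ψ (r * Real.sin θ))
    (f' := fun θ => deriv ψ (r * Real.sin θ) * (r * Real.cos θ))
    (g := fun q => √(U.toFun q - c))
    (fun θ _ => (hasDerivAt_of_contDiffOn_Ioo h.contDiffOn _ (mul_sin_mem hr θ)).comp θ
      ((Real.hasDerivAt_sin θ).const_mul r))
    ((continuous_comp_mul_sin (contDiffOn_deriv_Ioo h.contDiffOn).continuousOn hr).mul
      (continuous_const.mul Real.continuous_cos)).continuousOn hcont
  simp only [Real.sin_neg, Real.sin_pi_div_two, mul_neg, mul_one] at hsubst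
  rw [hF, ← hsubst, angularIntegral, ← intervalIntegral.integral_const_mul]
  refine intervalIntegral.integral_congr fun θ hθ => ?_
  rw [uIcc_of_le (by linarith [Real.pi_pos])] at hθ
  have hcos := Real.cos_nonneg_of_mem_Icc hθ
  have hsq : U.toFun (ψ (r * Real.sin θ)) - c = (r * Real.cos θ) ^ 2 := by
    rw [h.apply _ (mul_sin_mem hr θ)]
    linear_combination (-1 : ℝ) * hrsq - r ^ 2 * Real.sin_sq_add_cos_sq θ
  simp only [Function.comp]
  rw [hsq, Real.sqrt_sq (mul_nonneg hr0 hcos)]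
  ring

/-- `-F₁'` as a function of the level. -/
noncomputable def negDeriv (U : SmoothPeriodic) (ψ : ℝ → ℝ) (c : ℝ) : ℝ :=
  1 / 2 * angularIntegral (fun _ => 1) (deriv ψ) √(c₁ U.toFun - c)

/-- `-F₁''` as a function of the level; the divided difference takes care of the endpoint `c₁`. -/
noncomputable def negDerivDeriv (U : SmoothPeriodic) (ψ : ℝ → ℝ) (c : ℝ) : ℝ :=
  -(1 / 4) * dslope (angularIntegral (fun θ => 1 * Real.sin θ) (deriv (deriv ψ))) 0
    √(c₁ U.toFun - c)

theorem hasDerivAt_sqrt_const_sub {b c : ℝ} (hc : c < b) :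
    HasDerivAt (fun c => √(b - c)) (-1 / (2 * √(b - c))) c := by
  have := ((hasDerivAt_id c).const_sub b).sqrt (by simp only [id]; linarith)
  exact this

theorem IsMorseInverse.isJet (h : IsMorseInverse U m Y ψ) :
    IsJet U.toFun (negDeriv U ψ) (negDerivDeriv U ψ) (deriv (negDerivDeriv U ψ)) := by
  set b := c₁ U.toFun with hb
  set a := c₂ U.toFun with ha
  have hab : a < b := by
    have := h.sq
    have := pow_pos h.pos 2
    linarith
  have h1 := contDiffOn_deriv_Ioo h.contDiffOn
  have h2 := contDiffOn_deriv_Ioo h1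
  have hY0 : |(0 : ℝ)| < Y := by simpa using h.pos
  have hW : ∀ r, |r| < Y → HasDerivAt (angularIntegral (fun _ => 1) (deriv ψ))
      (angularIntegral (fun θ => 1 * Real.sin θ) (deriv (deriv ψ)) r) r := fun r hr =>
    hasDerivAt_angularIntegral h1 continuous_const hr
  have hW1 : ∀ r, |r| < Y → DifferentiableAt ℝ
      (angularIntegral (fun θ => 1 * Real.sin θ) (deriv (deriv ψ))) r := fun r hr =>
    (hasDerivAt_angularIntegral h2 (continuous_const.mul Real.continuous_sin) hr).differentiableAt
  have hrpos : ∀ c ∈ Ioo a b, 0 < √(b - c) := fun c hc => Real.sqrt_pos.2 (by linarith [hc.2])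
  have hsq : ContinuousAt (fun c => √(b - c)) b := by fun_prop
  have hsqb : √(b - b) = 0 := by simp
  have hcontG : ContinuousAt (negDeriv U ψ) b := by
    refine continuousAt_const.mul (ContinuousAt.comp (f := fun c => √(b - c))
      (g := angularIntegral (fun _ => 1) (deriv ψ)) ?_ hsq)
    exact (hW _ (by rwa [hsqb])).continuousAt
  have hcontG1 : ContinuousAt (negDerivDeriv U ψ) b := by
    refine continuousAt_const.mul (ContinuousAt.comp (f := fun c => √(b - c)) ?_ hsq)
    simp only [hsqb]
    exact continuousAt_dslope_same.2 (hW1 0 hY0)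
  have hd0 : ∀ c ∈ Ioo a b, HasDerivAt (F₁ U.toFun) (-negDeriv U ψ c) c := by
    intro c hc
    have hr := hrpos c hc
    have hcomp : HasDerivAt (fun c => √(b - c) ^ 2 *
        angularIntegral (fun θ => Real.cos θ ^ 2) (deriv ψ) √(b - c)) _ c :=
      HasDerivAt.comp c (hasDerivAt_sq_mul_angularIntegral h1 (h.sqrt_lt hc.1))
      (hasDerivAt_sqrt_const_sub hc.2)
    have heq : F₁ U.toFun =ᶠ[𝓝 c] fun c => √(b - c) ^ 2 *
        angularIntegral (fun θ => Real.cos θ ^ 2) (deriv ψ) √(b - c) := by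
      filter_upwards [Ioo_mem_nhds hc.1 hc.2] with x hx using h.F₁_eq ⟨hx.1, hx.2.le⟩
    refine (hcomp.congr_of_eventuallyEq heq).congr_deriv ?_
    simp only [negDeriv, ← hb]
    field_simp
  have hd1 : ∀ c ∈ Ioo a b, HasDerivAt (negDeriv U ψ) (negDerivDeriv U ψ c) c := by
    intro c hc
    have hr := hrpos c hc
    have hcomp := (HasDerivAt.comp c (hW _ (h.sqrt_lt hc.1))
      (hasDerivAt_sqrt_const_sub hc.2)).const_mul (1 / 2 : ℝ)
    refine HasDerivAt.congr_deriv hcomp ?_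
    simp only [negDerivDeriv, ← hb]
    rw [dslope_of_ne _ hr.ne', slope_def_field, angularIntegral_sin_zero, sub_zero, sub_zero]
    field_simp
    ring
  have hd2 : ∀ c ∈ Ioo a b, DifferentiableAt ℝ (negDerivDeriv U ψ) c := by
    intro c hc
    have hr := hrpos c hc
    refine DifferentiableAt.const_mul (DifferentiableAt.comp (f := fun c => √(b - c)) c ?_
      (hasDerivAt_sqrt_const_sub hc.2).differentiableAt) _
    exact (differentiableAt_dslope_of_ne hr.ne').2 (hW1 _ (h.sqrt_lt hc.1))
  have hnhds : Ioo a b ∈ 𝓝[<] b := Ioo_mem_nhdsLT hab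
  refine ⟨hd0, hd1, fun c hc => (hd2 c hc).hasDerivAt, ?_, ?_, hcontG1.continuousWithinAt, ?_⟩
  · refine hasDerivWithinAt_Iic_of_tendsto_deriv
      (fun c hc => (hd0 c hc).differentiableAt.differentiableWithinAt) ?_ hnhds ?_
    · have hB : ContinuousAt (fun c => √(b - c) ^ 2 *
          angularIntegral (fun θ => Real.cos θ ^ 2) (deriv ψ) √(b - c)) b := by
        refine ContinuousAt.comp (f := fun c => √(b - c)) (g := fun r => r ^ 2 *
          angularIntegral (fun θ => Real.cos θ ^ 2) (deriv ψ) r) ?_ hsq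
        exact (hasDerivAt_sq_mul_angularIntegral h1 (by rwa [hsqb])).continuousAt
      exact hB.continuousWithinAt.congr (fun c hc => h.F₁_eq ⟨hc.1, hc.2.le⟩)
        (h.F₁_eq ⟨hab, le_rfl⟩)
    · refine (hcontG.neg.tendsto.mono_left nhdsWithin_le_nhds).congr' ?_
      filter_upwards [hnhds] with c hc using (hd0 c hc).deriv.symm
  · refine hasDerivWithinAt_Iic_of_tendsto_deriv
      (fun c hc => (hd1 c hc).differentiableAt.differentiableWithinAt) hcontG.continuousWithinAt
      hnhds ?_
    refine (hcontG1.tendsto.mono_left nhdsWithin_le_nhds).congr' ?_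
    filter_upwards [hnhds] with c hc using (hd1 c hc).deriv.symm
  · intro c hc
    refine mul_pos (by norm_num) ?_
    refine intervalIntegral.intervalIntegral_pos_of_pos ?_ (fun θ => ?_)
      (by linarith [Real.pi_pos])
    · exact (continuous_const.mul (continuous_comp_mul_sin h1.continuousOn
        (h.sqrt_lt hc.1))).intervalIntegrable _ _
    · rw [one_mul]
      exact h.deriv_pos _ (mul_sin_mem (h.sqrt_lt hc.1) θ)

end morse

/-! ### Behaviour of `F₁` near the minimum value -/

/-- The derivative of a function with bounded second derivative is controlled by the distance of
the function to its infimum. -/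
theorem SmoothPeriodic.exists_deriv_sq_le (U : SmoothPeriodic) :
    ∃ K > 0, ∀ q, deriv U.toFun q ^ 2 ≤ K * (U.toFun q - c₂ U.toFun) := by
  obtain ⟨-, -, hle⟩ := U.exists_min
  have hper : Function.Periodic (deriv (deriv U.toFun)) 1 := by
    have := U.periodic_iteratedDeriv 2
    rwa [iteratedDeriv_succ, iteratedDeriv_one] at this
  have hd1 : Differentiable ℝ U.toFun := U.contDiff.differentiable (by simp)
  have hd2 : Differentiable ℝ (deriv U.toFun) := U.contDiff_deriv.differentiable (by simp)
  obtain ⟨C, hC⟩ := isCompact_Icc.exists_bound_of_continuousOn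
    ((U.contDiff_deriv.continuous_deriv (by simp)).continuousOn (s := Icc (0 : ℝ) 1))
  obtain ⟨K, hK, hKb⟩ : ∃ K > 0, ∀ q, ‖deriv (deriv U.toFun) q‖ ≤ K := by
    refine ⟨|C| + 1, by positivity, fun q => ?_⟩
    obtain ⟨y, hy, hqy⟩ := hper.exists_mem_Ico₀ one_pos q
    rw [hqy]
    have := hC y (Ico_subset_Icc_self hy)
    linarith [le_abs_self C]
  refine ⟨4 * K, by positivity, fun q => ?_⟩
  set d := deriv U.toFun q with hd
  -- Taylor's inequality at the point `q + h`, for the (nearly) optimal step `h`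
  set h := -(d / (2 * K)) with hh
  have hlip : ∀ x, ‖deriv U.toFun x - d‖ ≤ K * ‖x - q‖ := fun x =>
    convex_univ.norm_image_sub_le_of_norm_deriv_le (fun y _ => hd2 y) (fun y _ => hKb y)
      (mem_univ q) (mem_univ x)
  have htaylor : ‖(U.toFun (q + h) - d * (q + h)) - (U.toFun q - d * q)‖ ≤
      K * ‖h‖ * ‖q + h - q‖ := by
    refine (convex_uIcc q (q + h)).norm_image_sub_le_of_norm_hasDerivWithin_le
      (f := fun x => U.toFun x - d * x) (f' := fun x => deriv U.toFun x - d)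
      (fun x _ => ?_) (fun x hx => ?_) left_mem_uIcc right_mem_uIcc
    · have := (hd1 x).hasDerivAt.sub ((hasDerivAt_id x).const_mul d)
      exact (HasDerivAt.congr_deriv this (by ring)).hasDerivWithinAt
    · refine (hlip x).trans (mul_le_mul_of_nonneg_left ?_ hK.le)
      have := abs_sub_left_of_mem_uIcc hx
      simpa using this
  rw [add_sub_cancel_left, Real.norm_eq_abs, Real.norm_eq_abs, mul_assoc, abs_mul_abs_self]
    at htaylor
  have h1 := (le_abs_self _).trans htaylor
  have h2 := hle (q + h)
  have h3 : d * h = -(d ^ 2 / (2 * K)) := by rw [hh]; field_simp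
  have h4 : K * (h * h) = d ^ 2 / (4 * K) := by rw [hh]; field_simp; ring
  have h5 : d ^ 2 / (2 * K) = 2 * (d ^ 2 / (4 * K)) := by field_simp; ring
  have h6 : d ^ 2 / (4 * K) ≤ U.toFun q - c₂ U.toFun := by linarith
  rw [div_le_iff₀ (by positivity)] at h6
  linarith

section

variable {U : SmoothPeriodic} {m Y : ℝ} {ψ : ℝ → ℝ}

/-- Close to the minimum value, a point of the period is close to a minimum point, so that `U''` is
bounded below there. -/
theorem IsMorseInverse.exists_le_deriv_deriv (h : IsMorseInverse U m Y ψ) :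
    ∃ μ > 0, ∃ δ > 0, ∀ y ∈ Ioo (-Y) Y, Y ^ 2 - y ^ 2 < δ → μ ≤ deriv (deriv U.toFun) (ψ y) := by
  have hcont : Continuous (deriv (deriv U.toFun)) := U.contDiff_deriv.continuous_deriv (by simp)
  have hper : Function.Periodic (deriv (deriv U.toFun)) 1 := by
    have := U.periodic_iteratedDeriv 2
    rwa [iteratedDeriv_succ, iteratedDeriv_one] at this
  have hm := h.deriv_deriv_min
  refine ⟨deriv (deriv U.toFun) m / 2, by linarith, ?_⟩
  have hS : IsCompact (Icc m (m + 1) ∩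
      {q | deriv (deriv U.toFun) q ≤ deriv (deriv U.toFun) m / 2}) :=
    isCompact_Icc.inter_right (isClosed_le hcont continuous_const)
  obtain ⟨v, hv, hvle⟩ := hS.exists_forall_le' (a := c₂ U.toFun) U.continuous.continuousOn (by
    rintro q ⟨hq, hq2⟩
    simp only [mem_ofPred_eq] at hq2
    rcases hq.1.eq_or_lt with rfl | h1
    · linarith
    rcases hq.2.eq_or_lt with rfl | h2
    · rw [hper] at hq2; linarith
    obtain ⟨y, hy, rfl⟩ := h.surjOn ⟨h1, h2⟩
    rw [h.apply y hy]
    have := h.sq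
    have : y ^ 2 < Y ^ 2 := sq_lt_sq' hy.1 hy.2
    linarith)
  refine ⟨v - c₂ U.toFun, by linarith, fun y hy hyδ => ?_⟩
  by_contra hcon
  have h1 := hvle (ψ y) ⟨Ioo_subset_Icc_self (h.mapsTo hy), (not_le.1 hcon).le⟩
  rw [h.apply y hy] at h1
  have := h.sq
  linarith

theorem IsMorseInverse.deriv_mul_deriv (h : IsMorseInverse U m Y ψ) {y : ℝ}
    (hy : y ∈ Ioo (-Y) Y) : deriv U.toFun (ψ y) * deriv ψ y = -(2 * y) := by
  have h1 := ((U.contDiff.differentiable (by simp)) (ψ y)).hasDerivAt.comp y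
    (hasDerivAt_of_contDiffOn_Ioo h.contDiffOn y hy)
  have h2 := (hasDerivAt_pow 2 y).const_sub (c₁ U.toFun)
  have heq : U.toFun ∘ ψ =ᶠ[𝓝 y] fun y => c₁ U.toFun - y ^ 2 := by
    filter_upwards [isOpen_Ioo.mem_nhds hy] with z hz using h.apply z hz
  rw [h1.unique (h2.congr_of_eventuallyEq heq)]
  simp

theorem IsMorseInverse.mul_deriv_deriv (h : IsMorseInverse U m Y ψ) {y : ℝ}
    (hy : y ∈ Ioo (-Y) Y) :
    y * deriv (deriv ψ) y = deriv ψ y + deriv (deriv U.toFun) (ψ y) / 2 * deriv ψ y ^ 3 := by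
  have h1 := ((U.contDiff_deriv.differentiable (by simp)) (ψ y)).hasDerivAt.comp y
    (hasDerivAt_of_contDiffOn_Ioo h.contDiffOn y hy)
  have h2 := h1.mul (hasDerivAt_of_contDiffOn_Ioo (contDiffOn_deriv_Ioo h.contDiffOn) y hy)
  have h3 := ((hasDerivAt_id y).const_mul 2).neg
  have heq : (deriv U.toFun ∘ ψ) * deriv ψ =ᶠ[𝓝 y] -(fun y => 2 * id y) := by
    filter_upwards [isOpen_Ioo.mem_nhds hy] with z hz using h.deriv_mul_deriv hz
  have h4 := h2.unique (h3.congr_of_eventuallyEq heq)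
  have h5 := h.deriv_mul_deriv hy
  simp only [Function.comp] at h4
  linear_combination (deriv (deriv ψ) y / 2) * h5 - (deriv ψ y / 2) * h4

/-- The blow-up of `ψ''` near the minimum points of `U`, and its domination over `ψ'`. -/
theorem IsMorseInverse.exists_blowup (h : IsMorseInverse U m Y ψ) {d : ℝ} (hd : 0 < d) :
    ∃ κ > 0, ∃ s₀ > 0, ∀ r, 0 < r → r < Y → ∀ y ∈ Ioo (-Y) Y, ∀ s, 0 < s → s ≤ s₀ →
      Y ^ 2 - y ^ 2 ≤ s ^ 2 →
      κ / s ^ 3 ≤ d / (2 * r ^ 2) * (y * deriv (deriv ψ) y) - deriv ψ y := by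
  obtain ⟨K, hK, hKb⟩ := U.exists_deriv_sq_le
  obtain ⟨μ, hμ, δ, hδ, hμb⟩ := h.exists_le_deriv_deriv
  have hY := h.pos
  obtain ⟨L, hL, hL2⟩ : ∃ L > 0, L ^ 2 = 2 * Y ^ 2 / K :=
    ⟨√(2 * Y ^ 2 / K), Real.sqrt_pos.2 (by positivity), Real.sq_sqrt (by positivity)⟩
  set κ := d * μ / (4 * Y ^ 2) with hκdef
  have hκ : 0 < κ := by positivity
  obtain ⟨s₀, hs₀, hs1, hs2, hs3⟩ : ∃ s₀ > 0, s₀ ^ 2 ≤ Y ^ 2 / 2 ∧ s₀ ^ 2 < δ ∧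
      2 * s₀ ^ 2 ≤ κ * L ^ 2 := by
    set ε := min (Y ^ 2 / 2) (min (δ / 2) (κ * L ^ 2 / 2)) with hε
    have hεpos : 0 < ε := by positivity
    refine ⟨√ε, Real.sqrt_pos.2 hεpos, ?_⟩
    rw [Real.sq_sqrt hεpos.le]
    have h1 : ε ≤ Y ^ 2 / 2 := min_le_left _ _
    have h2 : ε ≤ δ / 2 := (min_le_right _ _).trans (min_le_left _ _)
    have h3 : ε ≤ κ * L ^ 2 / 2 := (min_le_right _ _).trans (min_le_right _ _)
    exact ⟨h1, by linarith, by linarith⟩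
  refine ⟨κ * L ^ 3 / 2, by positivity, s₀, hs₀, fun r hr hrY y hy s hs hss hys => ?_⟩
  have hssq : s ^ 2 ≤ s₀ ^ 2 := pow_le_pow_left₀ hs.le hss 2
  have hψ := h.deriv_pos y hy
  set p := deriv ψ y with hp
  have hU2 := hμb y hy (by linarith)
  -- `ψ' ≥ L / s`
  have hps : L ≤ p * s := by
    have h1 := h.deriv_mul_deriv hy
    have h2 := hKb (ψ y)
    rw [h.apply y hy] at h2
    have h3 : c₁ U.toFun - y ^ 2 - c₂ U.toFun = Y ^ 2 - y ^ 2 := by rw [h.sq]; ring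
    rw [h3] at h2
    have h4 : 4 * y ^ 2 ≤ K * (p * s) ^ 2 := by
      have h5 : 4 * y ^ 2 = deriv U.toFun (ψ y) ^ 2 * p ^ 2 := by
        rw [← mul_pow, h1]; ring
      rw [h5, mul_pow]
      have h6 : deriv U.toFun (ψ y) ^ 2 ≤ K * s ^ 2 :=
        h2.trans (mul_le_mul_of_nonneg_left hys hK.le)
      nlinarith [mul_le_mul_of_nonneg_right h6 (sq_nonneg p)]
    have h7 : L ^ 2 ≤ (p * s) ^ 2 := by
      rw [hL2, div_le_iff₀ hK]
      nlinarith
    exact le_of_sq_le_sq h7 (by positivity)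
  have hp2 : 2 ≤ κ * p ^ 2 := by
    have h1 : L ^ 2 ≤ p ^ 2 * s ^ 2 := by
      rw [← mul_pow]; exact pow_le_pow_left₀ hL.le hps 2
    have h2 : κ * L ^ 2 ≤ κ * p ^ 2 * s₀ ^ 2 := by
      rw [mul_assoc]
      exact mul_le_mul_of_nonneg_left
        (h1.trans (mul_le_mul_of_nonneg_left hssq (sq_nonneg p))) hκ.le
    have h3 : 0 < s₀ ^ 2 := by positivity
    by_contra hcon
    have := mul_lt_mul_of_pos_right (not_le.1 hcon) h3
    linarith
  have hp3 : (L / s) ^ 3 ≤ p ^ 3 :=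
    pow_le_pow_left₀ (by positivity) ((div_le_iff₀ hs).2 hps) 3
  have hyψ : μ / 2 * p ^ 3 ≤ y * deriv (deriv ψ) y := by
    rw [h.mul_deriv_deriv hy]
    have := mul_le_mul_of_nonneg_right hU2 (show 0 ≤ p ^ 3 by positivity)
    linarith
  have hdr : d / (2 * Y ^ 2) ≤ d / (2 * r ^ 2) := by
    refine div_le_div_of_nonneg_left hd.le (by positivity) ?_
    have := pow_le_pow_left₀ hr.le hrY.le 2
    linarith
  have hmain : κ * p ^ 3 ≤ d / (2 * r ^ 2) * (y * deriv (deriv ψ) y) := by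
    have h1 : κ * p ^ 3 = d / (2 * Y ^ 2) * (μ / 2 * p ^ 3) := by rw [hκdef]; field_simp; ring
    rw [h1]
    exact mul_le_mul hdr hyψ (by positivity) (by positivity)
  have h8 : κ * L ^ 3 / 2 / s ^ 3 = κ / 2 * (L / s) ^ 3 := by field_simp
  rw [h8]
  have h9 : κ / 2 * (L / s) ^ 3 ≤ κ / 2 * p ^ 3 := mul_le_mul_of_nonneg_left hp3 (by positivity)
  have h10 : p ≤ κ / 2 * p ^ 3 := by nlinarith
  linarith

/-- Away from the minimum points of `U` the quantity of `exists_blowup` is bounded below. -/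
theorem IsMorseInverse.exists_lower_bound (h : IsMorseInverse U m Y ψ) {d : ℝ} (hd : 0 < d)
    {s₀ : ℝ} (hs₀ : 0 < s₀) :
    ∃ C ≥ 0, ∀ r, Y ^ 2 / 2 ≤ r ^ 2 → ∀ y ∈ Ioo (-Y) Y, s₀ ^ 2 ≤ Y ^ 2 - y ^ 2 →
      -C ≤ d / (2 * r ^ 2) * (y * deriv (deriv ψ) y) - deriv ψ y := by
  have hY := h.pos
  have h1 := contDiffOn_deriv_Ioo h.contDiffOn
  have h2 := contDiffOn_deriv_Ioo h1
  set Y' := √(Y ^ 2 - s₀ ^ 2) with hY'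
  have hY'lt : Y' < Y := by
    rw [hY', Real.sqrt_lt' hY]
    have := pow_pos hs₀ 2
    linarith
  have hsub : Icc (-Y') Y' ⊆ Ioo (-Y) Y := fun y hy => ⟨by linarith [hy.1], by linarith [hy.2]⟩
  obtain ⟨A, hA⟩ := isCompact_Icc.exists_bound_of_continuousOn (h1.continuousOn.mono hsub)
  obtain ⟨B, hB⟩ := isCompact_Icc.exists_bound_of_continuousOn (h2.continuousOn.mono hsub)
  refine ⟨d / Y ^ 2 * (Y * |B|) + |A|, by positivity, fun r hr y hy hys => ?_⟩
  have hmem : y ∈ Icc (-Y') Y' := by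
    rw [mem_Icc, ← abs_le]
    exact Real.abs_le_sqrt (by linarith)
  have hA' := (le_abs_self _).trans ((hA y hmem).trans (le_abs_self A))
  have hB' := (hB y hmem).trans (le_abs_self B)
  have hprod : |y * deriv (deriv ψ) y| ≤ Y * |B| := by
    rw [abs_mul]
    exact mul_le_mul (abs_lt.2 hy).le hB' (abs_nonneg _) hY.le
  have hY2 : 0 < Y ^ 2 := by positivity
  have hr2 : 0 < r ^ 2 := by linarith
  have hdr : d / (2 * r ^ 2) ≤ d / Y ^ 2 :=
    div_le_div_of_nonneg_left hd.le hY2 (by linarith)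
  have h3 : d / (2 * r ^ 2) * |y * deriv (deriv ψ) y| ≤ d / Y ^ 2 * (Y * |B|) :=
    mul_le_mul hdr hprod (abs_nonneg _) (by positivity)
  have h4 : -(d / (2 * r ^ 2) * |y * deriv (deriv ψ) y|) ≤
      d / (2 * r ^ 2) * (y * deriv (deriv ψ) y) := by
    rw [← mul_neg]
    exact mul_le_mul_of_nonneg_left (neg_abs_le _) (by positivity)
  linarith

/-- Near the minimum value the second derivative of `F₁` dominates the first one: `F₁'` diverges
like `log (c - c₂)`, and `F₁''` like `1 / (c - c₂)`. -/
theorem IsMorseInverse.exists_near_min (h : IsMorseInverse U m Y ψ) (h0 : 0 < c₂ U.toFun) :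
    ∃ ε > 0, c₂ U.toFun + ε ≤ c₁ U.toFun ∧ ∀ c ∈ Ioo (c₂ U.toFun) (c₂ U.toFun + ε),
      negDeriv U ψ c + c₂ U.toFun * negDerivDeriv U ψ c < 0 := by
  obtain ⟨κ, hκ, s₀, hs₀, hblow⟩ := h.exists_blowup h0
  obtain ⟨C, hC, hlow⟩ := h.exists_lower_bound h0 hs₀
  have hY := h.pos
  have h1 := contDiffOn_deriv_Ioo h.contDiffOn
  have h2 := contDiffOn_deriv_Ioo h1
  obtain ⟨A, hA, hA2⟩ : ∃ A > 0, A ^ 2 = 1 + Y ^ 2 :=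
    ⟨√(1 + Y ^ 2), Real.sqrt_pos.2 (by positivity), Real.sq_sqrt (by positivity)⟩
  have hpi := Real.pi_pos
  set ε := min (min 1 (Y ^ 2 / 2)) (min ((s₀ / A) ^ 2) (κ / (A ^ 3 * (C * Real.pi + 1)))) with hε
  have hεpos : 0 < ε := by positivity
  have he1 : ε ≤ 1 := (min_le_left _ _).trans (min_le_left _ _)
  have he2 : ε ≤ Y ^ 2 / 2 := (min_le_left _ _).trans (min_le_right _ _)
  have he3 : ε ≤ (s₀ / A) ^ 2 := (min_le_right _ _).trans (min_le_left _ _)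
  have he4 : ε ≤ κ / (A ^ 3 * (C * Real.pi + 1)) := (min_le_right _ _).trans (min_le_right _ _)
  have hsqY := h.sq
  have hY2 : 0 < Y ^ 2 := by positivity
  refine ⟨ε, hεpos, by linarith, fun c hc => ?_⟩
  set r := √(c₁ U.toFun - c) with hrdef
  set ρ := √(c - c₂ U.toFun) with hρdef
  have hrY : |r| < Y := h.sqrt_lt hc.1
  have hr : 0 < r := Real.sqrt_pos.2 (by linarith [hc.2])
  have hrsq : r ^ 2 = c₁ U.toFun - c := Real.sq_sqrt (by linarith [hc.2])
  have hρ : 0 < ρ := Real.sqrt_pos.2 (by linarith [hc.1])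
  have hρsq : ρ ^ 2 = c - c₂ U.toFun := Real.sq_sqrt (by linarith [hc.1])
  have hrρ : r ^ 2 = Y ^ 2 - ρ ^ 2 := by linarith
  have hρε : ρ ^ 2 < ε := by linarith [hc.2]
  have hρ1 : ρ < 1 := by nlinarith
  have hAρ : A * ρ ≤ s₀ := by
    rw [mul_comm, ← le_div_iff₀ hA]
    exact le_of_sq_le_sq (hρε.le.trans he3) (by positivity)
  let k : ℝ → ℝ := fun θ => c₂ U.toFun / (2 * r ^ 2) *
    (r * Real.sin θ * deriv (deriv ψ) (r * Real.sin θ)) - deriv ψ (r * Real.sin θ)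
  have hc1 := continuous_comp_mul_sin h1.continuousOn hrY
  have hc2 := continuous_comp_mul_sin h2.continuousOn hrY
  have hkc : Continuous k :=
    (continuous_const.mul ((continuous_const.mul Real.continuous_sin).mul hc2)).sub hc1
  have hki : ∀ a b, IntervalIntegrable k volume a b := fun a b => hkc.intervalIntegrable a b
  -- the bound valid for all angles
  have hkC : ∀ θ, -C ≤ k θ := by
    intro θ
    have hmem := mul_sin_mem hrY θ
    rcases le_total (s₀ ^ 2) (Y ^ 2 - (r * Real.sin θ) ^ 2) with hle | hle
    · exact hlow r (by linarith) _ hmem hle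
    · have := hblow r hr ((le_abs_self r).trans_lt hrY) _ hmem s₀ hs₀ le_rfl hle
      have h3 : 0 < κ / s₀ ^ 3 := by positivity
      linarith
  -- the bound valid for angles at distance at most `ρ` from `π / 2`
  have hkρ : ∀ θ ∈ Icc (Real.pi / 2 - ρ) (Real.pi / 2), κ / (A * ρ) ^ 3 ≤ k θ := by
    intro θ hθ
    refine hblow r hr ((le_abs_self r).trans_lt hrY) _ (mul_sin_mem hrY θ) (A * ρ) (by positivity)
      hAρ ?_
    have h3 : Real.cos θ ^ 2 ≤ ρ ^ 2 := by
      rw [← Real.sin_pi_div_two_sub]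
      have h4 : Real.sin (Real.pi / 2 - θ) ≤ Real.pi / 2 - θ := Real.sin_le (by linarith [hθ.2])
      have h5 : 0 ≤ Real.sin (Real.pi / 2 - θ) :=
        Real.sin_nonneg_of_nonneg_of_le_pi (by linarith [hθ.2])
          (by linarith [hθ.1, Real.pi_gt_three])
      exact pow_le_pow_left₀ h5 (by linarith [hθ.1]) 2
    have h6 : Y ^ 2 - (r * Real.sin θ) ^ 2 = ρ ^ 2 + r ^ 2 * Real.cos θ ^ 2 := by
      linear_combination (-1 : ℝ) * hrρ - r ^ 2 * Real.sin_sq_add_cos_sq θ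
    rw [h6, mul_pow, hA2]
    have h7 : r ^ 2 * Real.cos θ ^ 2 ≤ Y ^ 2 * ρ ^ 2 :=
      mul_le_mul (by linarith [sq_nonneg ρ]) h3 (sq_nonneg _) hY2.le
    linarith
  have hint : 0 < ∫ θ in (-(Real.pi / 2))..(Real.pi / 2), k θ := by
    rw [← intervalIntegral.integral_add_adjacent_intervals (hki _ (Real.pi / 2 - ρ)) (hki _ _)]
    have hle1 : -(Real.pi / 2) ≤ Real.pi / 2 - ρ := by linarith [Real.pi_gt_three]
    have hI1 := intervalIntegral.integral_mono_on hle1 intervalIntegrable_const (hki _ _)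
      (fun θ _ => hkC θ)
    have hI2 := intervalIntegral.integral_mono_on (show Real.pi / 2 - ρ ≤ Real.pi / 2 by linarith)
      intervalIntegrable_const (hki _ _) hkρ
    rw [intervalIntegral.integral_const, smul_eq_mul] at hI1 hI2
    have h3 : (Real.pi / 2 - (Real.pi / 2 - ρ)) * (κ / (A * ρ) ^ 3) = κ / A ^ 3 / ρ ^ 2 := by
      field_simp
      ring
    have h4 : C * Real.pi < κ / A ^ 3 / ρ ^ 2 := by
      rw [lt_div_iff₀ (by positivity)]
      have h5 := hρε.le.trans he4
      rw [← div_div, le_div_iff₀ (by positivity)] at h5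
      have : 0 < ρ ^ 2 := by positivity
      linarith
    have h6 : 0 ≤ C * ρ := by positivity
    rw [h3] at hI2
    linarith
  have hfinal : negDeriv U ψ c + c₂ U.toFun * negDerivDeriv U ψ c =
      -(1 / 2) * ∫ θ in (-(Real.pi / 2))..(Real.pi / 2), k θ := by
    have hi1 : Continuous fun θ => c₂ U.toFun / (2 * r) *
        (1 * Real.sin θ * deriv (deriv ψ) (r * Real.sin θ)) :=
      continuous_const.mul ((continuous_const.mul Real.continuous_sin).mul hc2)
    have hi2 : Continuous fun θ => 1 * deriv ψ (r * Real.sin θ) := continuous_const.mul hc1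
    have hk : ∫ θ in (-(Real.pi / 2))..(Real.pi / 2), k θ =
        c₂ U.toFun / (2 * r) * angularIntegral (fun θ => 1 * Real.sin θ) (deriv (deriv ψ)) r -
          angularIntegral (fun _ => 1) (deriv ψ) r := by
      rw [angularIntegral, angularIntegral, ← intervalIntegral.integral_const_mul,
        ← intervalIntegral.integral_sub (hi1.intervalIntegrable _ _) (hi2.intervalIntegrable _ _)]
      refine intervalIntegral.integral_congr fun θ _ => ?_
      simp only [k]
      field_simp
    rw [hk, negDeriv, negDerivDeriv, ← hrdef, dslope_of_ne _ hr.ne', slope_def_field,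
      angularIntegral_sin_zero, sub_zero, sub_zero]
    field_simp
    ring
  rw [hfinal]
  linarith

end

/-- The nondegenerate potentials are dense: a small constant added to a given potential suffices. -/
theorem dense_isNondegenerate : Dense {U : OmegaRev | IsNondegenerate U.1} := by
  refine dense_of_ae_addConst fun U hU => ?_
  obtain ⟨m, Y, ψ, hψ⟩ := exists_isMorseInverse hU
  have h0 : 0 < c₂ U.toFun := by
    obtain ⟨q, hq, -⟩ := U.exists_min
    exact hq ▸ hU.1 q
  obtain ⟨ε, hε, hεle, hmin⟩ := hψ.exists_near_min h0
  exact ⟨c₂ U.toFun / 2, by linarith, hψ.isJet.volume_not_isNondegenerate hU h0 (by linarith)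
    (fun V _ c hc => curvature_ne_zero_of_lt_min V hc) hε hεle hmin⟩

end RevolutionTorus

theorem mainTheorem4 :
    Dense {U : RevolutionTorus.OmegaRev | RevolutionTorus.IsNondegenerate U.1} := by
  exact RevolutionTorus.dense_isNondegenerate
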